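/- Let $\mathbb T^1=\mathbb R/\mathbb Z$ and $\mathbb T^2=\mathbb R^2/\mathbb Z^2$, with Lebesgue measures $\lambda$ and $\mu$, and let $\phi^t(x_1,x_2)=(x_1+t,x_2)$ on $\mathbb T^2$. **Analytic topology.** For $\rho>0$ let $\Omega_\rho=\{(z_1,z_2)\in\mathbb C^2:|\mathrm{Im}\,z_1|<\rho,\ |\mathrm{Im}\,z_2|<\rho\}$ and let $\|f\|_\rho$ be the supremum of $|f|$ over $\Omega_\rho$. $\mathrm{Diff}^\omega_\rho(\mathbb T^2,\mu)$ is the set of $\mu$-preserving real-analytic diffeomorphisms of $\mathbb T^2$ homotopic to the identity that have a lift $(x_1+f_1,x_2+f_2)$ to $\mathbb R^2$ with $f_1,f_2$ real-analytic, $\mathbb Z^2$-periodic, and extending holomorphically to $\Omega_\rho$ with $\|f_i\|_\rho<\infty$. Its metric is $d_\rho(F,G)=\max_{i}\inf_{m\in\mathbb Z}\|f_i-g_i+m\|_\rho$. For an analytic map $H$ of $\mathbb T^2$ let $\|DH\|_0$ be the supremum over $\mathbb R^2$ of the absolute values of the four first partial derivatives of a lift of $H$. **Approximate step functions.** For integers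 $k,N\ge1$, reals $a_0,\dots,a_{k-1}$ and $\varepsilon,\delta>0$, call a function $s:\mathbb R\to\mathbb R$ an $(\varepsilon,\delta)$-approximation of $(a_0,\dots,a_{k-1};N)$ if $s$ is $\frac1N$-periodic, is the restriction of an entire function, and $\sup_{x\in[0,1)\setminus F}|s(x)-\tilde s(x)|<\varepsilon$. Here $\tilde s=a_{i\bmod k}$ on $[\frac i{kN},\frac{i+1}{kN})$ for $0\le i<kN$, and $F$ is the union of the closed intervals (mod 1) of length $\frac{\delta}{kN}$ centred at the points $\frac i{kN}$. **Construction.** Start from integers $0\le p_0<q_0$ and $H_0=\mathrm{id}$. Given $p_n,q_n,H_n$, with $\alpha_n=p_n/q_n$, do the following for $n=0,1,2,\dots$. 1. Choose an integer $l_n>2^n\|DH_n\|_0$. 2. Put $\delta=3\varepsilon=\frac{1}{2^{l_n^2q_n}\,l_n^2q_n}$ and choose $(\varepsilon,\delta)$-approximations - $\psi_{1}$ of $(a_0,\dots,a_{l_n-1};1)$ with $a_0=0$ and $a_i=\frac{l_n-i}{l_n^2q_n}$ for $1\le i<l_n$, - $\psi_{2}$ of $(a_0,\dots,a_{l_n-1};l_nq_n)$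 with $a_i=\frac{i}{l_n}$, - $\psi_{3}$ of $(a_0,\dots,a_{l_n-1};1)$ with $a_i=\frac{i}{l_n^2q_n}$. 3. Let $h_{n+1}=h_4\circ h_3\circ h_2\circ h_1$, where $h_1(x_1,x_2)=(x_1+\psi_1(x_2),x_2)$, $h_2(x_1,x_2)=(x_1,x_2+\psi_2(x_1))$, $h_3(x_1,x_2)=(x_1-\psi_3(x_2),x_2)$, $h_4(x_1,x_2)=(x_1,x_2+q_nx_1)$, and put $H_{n+1}=h_{n+1}\circ H_n$. 4. Choose an integer $k_n\ge1$ and put $p_{n+1}=k_nl_n^2p_n+1$, $q_{n+1}=k_nl_n^2q_n$. Let $T_n=H_n^{-1}\circ\phi^{\alpha_n}\circ H_n$. A *threshold* is a function $\kappa$ assigning a natural number to each tuple $(n,p_n,q_n,H_n,l_n,h_{n+1})$; the construction *exceeds* $\kappa$ if $k_n\ge\kappa(n,p_n,q_n,H_n,l_n,h_{n+1})$ for every $n$. **Proposition.** The construction can be carried out with all $k_n$ arbitrarily large: for every threshold $\kappa$ and all integers $0\le p_0<q_0$, some construction starting from $p_0,q_0$ exceeds $\kappa$. Moreover, if the $k_n$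 are sufficiently large, then the limit of the $T_n$ exists and is isomorphic to an irrational rotation. Precisely, there is a threshold $\kappa$ such that, for every construction exceeding $\kappa$ (from any $0\le p_0<q_0$), the following hold: - $\alpha=\lim_{n\to\infty}p_n/q_n$ exists and is irrational; - there is a real-analytic diffeomorphism $T$ of $\mathbb T^2$ that preserves $\mu$ and such that, for every $\rho>0$, all $T_n$ and $T$ lie in $\mathrm{Diff}^\omega_\rho(\mathbb T^2,\mu)$ and $d_\rho(T_n,T)\to0$; - $(\mathbb T^2,\mu,T)$ is metrically isomorphic (isomorphic mod $0$) to $(\mathbb T^1,\lambda,R_\alpha)$, where $R_\alpha(y)=y+\alpha$. -/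

import Mathlib

open MeasureTheory Filter Topology
open scoped ENNReal

noncomputable section

namespace AbC

/-- The two dimensional torus `ℝ² / ℤ²`; its `volume` is the (normalized) Lebesgue measure. -/
abbrev Torus : Type := UnitAddCircle × UnitAddCircle

/-- The covering projection `ℝ² → 𝕋²`. -/
def proj (x : ℝ × ℝ) : Torus := ((x.1 : UnitAddCircle), (x.2 : UnitAddCircle))

/-! ### Real-analytic diffeomorphisms of the torus and the analytic topology -/

/-- `F` is a real-analytic lift to `ℝ²` of the map `S` of the torus. -/
structure IsAnalyticLift (S : Torus → Torus) (F : ℝ × ℝ → ℝ × ℝ) : Prop where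
  analytic : AnalyticOnNhd ℝ F Set.univ
  lift : ∀ x, proj (F x) = S (proj x)

/-- A real-analytic diffeomorphism: a bijection that is real-analytic with real-analytic inverse
(a map of the torus is real-analytic iff it has a real-analytic lift to `ℝ²`). -/
def IsAnalyticDiffeo (T : Torus ≃ Torus) : Prop :=
  (∃ F, IsAnalyticLift T F) ∧ ∃ F, IsAnalyticLift T.symm F

/-- The sup norm over `ℝ²` of the entries of the derivative of (a lift of) `S`. All analytic lifts
differ by constants, so the infimum runs over equal values; it is `∞` if there is no lift. The norm
on `ℝ × ℝ` is the maximum norm, so this is the maximum over all four partial derivatives. -/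
def derivSup (S : Torus → Torus) : ℝ≥0∞ :=
  ⨅ (F : ℝ × ℝ → ℝ × ℝ) (_ : IsAnalyticLift S F),
    ⨆ x, max ‖fderiv ℝ F x (1, 0)‖ₑ ‖fderiv ℝ F x (0, 1)‖ₑ

/-- The complex neighbourhood `Ω_ρ` of `ℝ²` in `ℂ²`. -/
def strip (ρ : ℝ) : Set (ℂ × ℂ) := {z | |z.1.im| < ρ ∧ |z.2.im| < ρ}

/-- The norm `‖f‖_ρ`: the supremum over `Ω_ρ` of the modulus of the holomorphic extension of `f`
(which is unique for `ρ > 0`); it is `∞` if there is no holomorphic extension. -/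
def stripNorm (ρ : ℝ) (f : ℝ × ℝ → ℝ) : ℝ≥0∞ :=
  ⨅ (g : ℂ × ℂ → ℂ) (_ : DifferentiableOn ℂ g (strip ρ))
    (_ : ∀ x : ℝ × ℝ, g ((x.1 : ℂ), (x.2 : ℂ)) = (f x : ℂ)), ⨆ z ∈ strip ρ, ‖g z‖ₑ

/-- `ℤ²`-periodicity. -/
def IsPeriodic (f : ℝ × ℝ → ℝ) : Prop :=
  ∀ (x : ℝ × ℝ) (m n : ℤ), f (x.1 + m, x.2 + n) = f x

/-- The space `C^ω_ρ(𝕋²)`. -/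
structure MemAnalytic (ρ : ℝ) (f : ℝ × ℝ → ℝ) : Prop where
  periodic : IsPeriodic f
  analytic : AnalyticOnNhd ℝ f Set.univ
  bounded : stripNorm ρ f < ∞

/-- `(x₁, x₂) ↦ (x₁ + f₁(x₁, x₂), x₂ + f₂(x₁, x₂))` is a lift of `T`, with `f₁, f₂` continuous and
`ℤ²`-periodic (such a lift exists iff `T` is continuous and homotopic to the identity). -/
structure IsDisplacement (T : Torus → Torus) (f : Fin 2 → ℝ × ℝ → ℝ) : Prop where
  continuous : ∀ i, Continuous (f i)
  periodic : ∀ i, IsPeriodic (f i)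
  lift : ∀ x, T (proj x) = proj (x.1 + f 0 x, x.2 + f 1 x)

/-- The set `Diff^ω_ρ(𝕋², μ)` of Lebesgue measure preserving real-analytic diffeomorphisms that are
homotopic to the identity and whose displacement functions lie in `C^ω_ρ(𝕋²)`. -/
structure MemDiff (ρ : ℝ) (T : Torus ≃ Torus) : Prop where
  diffeo : IsAnalyticDiffeo T
  measurePreserving : MeasurePreserving T volume volume
  displacement : ∃ f, IsDisplacement T f ∧ ∀ i, MemAnalytic ρ (f i)

/-- The metric `d_ρ` of `Diff^ω_ρ(𝕋², μ)`. Displacement functions are unique up to integer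
constants, so the outer infimum runs over equal values. -/
def analyticDist (ρ : ℝ) (T S : Torus → Torus) : ℝ≥0∞ :=
  ⨅ (f : Fin 2 → ℝ × ℝ → ℝ) (g : Fin 2 → ℝ × ℝ → ℝ)
    (_ : IsDisplacement T f) (_ : IsDisplacement S g),
    ⨆ i, ⨅ m : ℤ, stripNorm ρ (fun x => f i x - g i x + m)

/-! ### Metric isomorphism -/

/-- Metric isomorphism (isomorphism mod `0`) of two measure preserving systems. -/
def MetricallyIsomorphic {X Y : Type*} [MeasurableSpace X] [MeasurableSpace Y]
    (μ : Measure X) (T : X → X) (ν : Measure Y) (S : Y → Y) : Prop :=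
  ∃ (K : X → Y) (J : Y → X), MeasurePreserving K μ ν ∧ MeasurePreserving J ν μ ∧
    (∀ᵐ x ∂μ, J (K x) = x) ∧ (∀ᵐ y ∂ν, K (J y) = y) ∧ ∀ᵐ x ∂μ, K (T x) = S (K x)

/-! ### The construction -/

/-- The step function on `[0,1)` with the value `a (i mod k)` on `[i/(kN), (i+1)/(kN))`. -/
def stepFun (k N : ℕ) (a : ℕ → ℝ) (x : ℝ) : ℝ := a (⌊(k : ℝ) * N * x⌋₊ % k)

/-- `s` is a `1/N`-periodic entire function, real on the real line, that satisfies
`sup |s - stepFun k N a| < ε` on `[0,1)` outside the intervals (mod `1`) of length `δ/(kN)` centred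
at the points `i/(kN)`. Being `1`-periodic, `s` is written as a function on the circle. -/
structure IsStepApprox (k N : ℕ) (a : ℕ → ℝ) (ε δ : ℝ) (s : UnitAddCircle → ℝ) : Prop where
  entire : ∃ g : ℂ → ℂ, Differentiable ℂ g ∧ ∀ x : ℝ, g (x : ℂ) = (s (x : UnitAddCircle) : ℂ)
  periodic : Function.Periodic (fun x : ℝ => s (x : UnitAddCircle)) (1 / (N : ℝ))
  near : ∃ ε' < ε, ∀ x ∈ Set.Ico (0 : ℝ) 1,
    (∀ i : ℕ, i ≤ k * N → δ / (2 * k * N) < |x - (i : ℝ) / (k * N)|) →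
      |s (x : UnitAddCircle) - stepFun k N a x| ≤ ε'

/-- The shear `(x₁, x₂) ↦ (x₁ + ψ(x₂), x₂)`. -/
def shearFst (ψ : UnitAddCircle → ℝ) : Torus ≃ Torus where
  toFun x := (x.1 + (ψ x.2 : UnitAddCircle), x.2)
  invFun x := (x.1 - (ψ x.2 : UnitAddCircle), x.2)
  left_inv x := by simp
  right_inv x := by simp

/-- The shear `(x₁, x₂) ↦ (x₁, x₂ + ψ(x₁))`. -/
def shearSnd (ψ : UnitAddCircle → ℝ) : Torus ≃ Torus where
  toFun x := (x.1, x.2 + (ψ x.1 : UnitAddCircle))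
  invFun x := (x.1, x.2 - (ψ x.1 : UnitAddCircle))
  left_inv x := by simp
  right_inv x := by simp

/-- The linear twist `(x₁, x₂) ↦ (x₁, x₂ + q x₁)`. -/
def twist (q : ℕ) : Torus ≃ Torus where
  toFun x := (x.1, x.2 + q • x.1)
  invFun x := (x.1, x.2 - q • x.1)
  left_inv x := by simp
  right_inv x := by simp

/-- The circle action `φ^t (x₁, x₂) = (x₁ + t, x₂)`. -/
def flow (t : ℝ) : Torus ≃ Torus := shearFst (fun _ => t)

/-- The state after `n` steps: the integers `p_n`, `q_n` and the conjugating map `H_n`. -/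
structure Stage where
  p : ℕ
  q : ℕ
  H : Torus ≃ Torus

/-- `α_n = p_n / q_n`. -/
def Stage.alpha (s : Stage) : ℝ := (s.p : ℝ) / s.q

/-- `T_n = H_n⁻¹ ∘ φ^{α_n} ∘ H_n`. -/
def Stage.T (s : Stage) : Torus ≃ Torus := (s.H.trans (flow s.alpha)).trans s.H.symm

/-- The choices made in passing from step `n` to step `n + 1`: the integers `l_n`, `k_n` and the
functions `ψ_{1,n+1}`, `ψ_{2,n+1}`, `ψ_{3,n+1}`. -/
structure Choice where
  l : ℕ
  k : ℕ
  ψ₁ : UnitAddCircle → ℝ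
  ψ₂ : UnitAddCircle → ℝ
  ψ₃ : UnitAddCircle → ℝ

/-- `h_{n+1} = h_{4,n+1} ∘ h_{3,n+1} ∘ h_{2,n+1} ∘ h_{1,n+1}`, where `q = q_n`. -/
def Choice.h (c : Choice) (q : ℕ) : Torus ≃ Torus :=
  (((shearFst c.ψ₁).trans (shearSnd c.ψ₂)).trans (shearFst (fun y => -c.ψ₃ y))).trans (twist q)

/-- `p_{n+1} = k_n l_n² p_n + 1`, `q_{n+1} = k_n l_n² q_n`, `H_{n+1} = h_{n+1} ∘ H_n`. -/
def Stage.next (s : Stage) (c : Choice) : Stage where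
  p := c.k * c.l ^ 2 * s.p + 1
  q := c.k * c.l ^ 2 * s.q
  H := s.H.trans (c.h s.q)

/-- The stages of the construction that starts from `p₀`, `q₀`, `H₀ = id`. -/
def stage (p₀ q₀ : ℕ) (c : ℕ → Choice) : ℕ → Stage
  | 0 => ⟨p₀, q₀, Equiv.refl Torus⟩
  | n + 1 => (stage p₀ q₀ c n).next (c n)

/-- The parameter `δ = 1 / (2^{l²q} l² q)`. -/
def errDelta (l q : ℕ) : ℝ := 1 / ((2 : ℝ) ^ (l ^ 2 * q) * ((l : ℝ) ^ 2 * q))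

/-- The requirements on the choices made at step `n`, except for the size of `k_n`:
`l_n > 2^n ‖DH_n‖₀`, `k_n ≥ 1`, and `ψ_{1,n+1}, ψ_{2,n+1}, ψ_{3,n+1}` are entire approximations, with
`3ε = δ`, of the three step functions of the construction. -/
structure Choice.Admissible (c : Choice) (n : ℕ) (s : Stage) : Prop where
  l_large : (2 : ℝ≥0∞) ^ n * derivSup s.H < (c.l : ℝ≥0∞)
  k_pos : 1 ≤ c.k
  approx₁ : IsStepApprox c.l 1
    (fun i => if i = 0 then 0 else ((c.l : ℝ) - i) / ((c.l : ℝ) ^ 2 * s.q))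
    (errDelta c.l s.q / 3) (errDelta c.l s.q) c.ψ₁
  approx₂ : IsStepApprox c.l (c.l * s.q) (fun i => (i : ℝ) / c.l)
    (errDelta c.l s.q / 3) (errDelta c.l s.q) c.ψ₂
  approx₃ : IsStepApprox c.l 1 (fun i => (i : ℝ) / ((c.l : ℝ) ^ 2 * s.q))
    (errDelta c.l s.q / 3) (errDelta c.l s.q) c.ψ₃

/-- A bound for the size of `k_n`: it may depend on `n`, on `p_n`, `q_n`, `H_n`, on `l_n` and on
`h_{n+1}`, that is, on what is known when `k_n` is chosen. -/
abbrev Threshold : Type := ℕ → Stage → ℕ → (Torus ≃ Torus) → ℕ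

/-- `c` is a run of the construction, from `p₀/q₀ ∈ [0,1)`, in which every `k_n` is at least as large
as the threshold `κ` requires. -/
structure IsConstruction (κ : Threshold) (p₀ q₀ : ℕ) (c : ℕ → Choice) : Prop where
  start : p₀ < q₀
  admissible : ∀ n, (c n).Admissible n (stage p₀ q₀ c n)
  k_large : ∀ n, κ n (stage p₀ q₀ c n) (c n).l ((c n).h (stage p₀ q₀ c n).q) ≤ (c n).k

end AbC

end

/-! The isomorphism onto the circle is `K x = lim (H_n x).1`; the work is to see that this limit
exists, remembers the whole point `x`, and turns `T` into the rotation by `α`.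

Geometry of one step (`near_of_mem_goodSet`). Write `l, q` for `l_n, q_n`, put `u = H_n x` and let
`y` be the first coordinate of `h_{n+1} u`. Cut the second coordinate into `l` cells of length `1/l`
and the first into cells of length `1/(l² q)`. Off a small set, if `u.2` is in cell `j` and the
sheared first coordinate is in a cell of index `r` mod `l`, then the second shear moves the second
coordinate to cell `j + r` mod `l`, and the third subtracts that index from the index of the first
cell. The index of the new cell is thus `-j` mod `l`. So `y` differs from `u.1` by at most `2/(l
q)`, and yet `u.2` equals `-l q y` up to `3/l`: the new first coordinate encodes the old second one.

The exceptional sets have measure at most `6 (1/2)^q` (`volume_goodSet_compl_le`), so by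
Borel-Cantelli almost every `x` is eventually controlled. For such `x` the first coordinates
converge to `K x`, and `H_n x` is within `5/l` of `(K x, -l q K x)`. Both `H_n` and its inverse are
Lipschitz with constant `2 l / 2^n`, the inverse because area preservation gives it the same
derivative entries up to order and sign (`EntireLift.dist_le`). Hence `x = lim H_n⁻¹ (K x, -l q K
x)`, which gives the inverse of `K`.

Dynamics. Since `h_{n+1}` commutes with `φ^{α_n}`, `T_n` and `T_{n+1}` are conjugates of `φ^{α_n}`
and `φ^{α_{n+1}}` by the same map `H_{n+1}` (`conjFlow_eq`). This map is entire and fixed before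
`k_n`, and `α_{n+1} - α_n = 1/q_{n+1}`, so a large `k_n` makes `T_{n+1}` as close to `T_n` as
desired on the strip of width `n + 1` (`exists_isCloseFrom`). Summable rates give a limit on every
strip (`exists_limit`); the same for the inverses makes it a diffeomorphism. The rates also beat the
Lipschitz constant of `H_n`, so `H_n ∘ T_n` and `H_n ∘ T` become close and `K ∘ T = K + α`. Finally
`k_n ≥ n + 2` makes the `α_n` approximate `α` too well for a rational number. -/

noncomputable section
namespace AbC

/-! ### Holomorphic functions of two variables are analytic -/

/-- The angles parametrizing a circle. -/
abbrev AngleInterval : Type := Set.Icc (0 : ℝ) (2 * Real.pi)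

/-- Lebesgue measure on the interval of angles. -/
def angleMeasure : Measure AngleInterval := Measure.comap Subtype.val volume

instance : IsFiniteMeasure angleMeasure := by
  refine ⟨?_⟩
  rw [angleMeasure, Measure.comap_apply _ Subtype.val_injective
    (fun s hs => measurableSet_Icc.subtype_image hs) _ MeasurableSet.univ, Set.image_univ,
    Subtype.range_coe]
  exact isCompact_Icc.measure_lt_top

/-- Integration over the square of angles, as a continuous linear functional. -/
def angleIntegral : C(AngleInterval × AngleInterval, ℂ) →L[ℂ] ℂ :=
  LinearMap.mkContinuous
    { toFun := fun f => ∫ x, f x ∂angleMeasure.prod angleMeasure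
      map_add' := fun f g => integral_add
        (f.continuous.integrable_of_hasCompactSupport (HasCompactSupport.of_compactSpace _))
        (g.continuous.integrable_of_hasCompactSupport (HasCompactSupport.of_compactSpace _))
      map_smul' := fun c f => integral_const_mul c _ }
    ((angleMeasure.prod angleMeasure).real Set.univ)
    (fun f => by
      have h := norm_integral_le_of_norm_le_const (μ := angleMeasure.prod angleMeasure)
        (f := f) (C := ‖f‖) (Eventually.of_forall fun x => f.norm_coe_le_norm x)
      exact h.trans_eq (mul_comm _ _))

/-- This form matches the definition of `circleIntegral`. `Set.projIcc` is the identity on the range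
of integration and only places the parameter in the compact space. -/
theorem angleIntegral_apply (f : C(AngleInterval × AngleInterval, ℂ)) :
    angleIntegral f = ∫ s in (0 : ℝ)..2 * Real.pi, ∫ t in (0 : ℝ)..2 * Real.pi,
      f (Set.projIcc 0 (2 * Real.pi) Real.two_pi_pos.le s,
        Set.projIcc 0 (2 * Real.pi) Real.two_pi_pos.le t) := by
  have key : ∀ g : AngleInterval → ℂ, ∫ s, g s ∂angleMeasure =
      ∫ s in (0 : ℝ)..2 * Real.pi, g (Set.projIcc 0 (2 * Real.pi) Real.two_pi_pos.le s) := by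
    intro g
    rw [intervalIntegral.integral_of_le Real.two_pi_pos.le, ← integral_Icc_eq_integral_Ioc,
      ← integral_subtype_comap measurableSet_Icc]
    refine integral_congr_ae (Eventually.of_forall fun s => ?_)
    simp
  have h1 : angleIntegral f = ∫ x, f x ∂angleMeasure.prod angleMeasure := rfl
  rw [h1]
  have hi : Integrable (fun x => f x) (angleMeasure.prod angleMeasure) :=
    f.continuous.integrable_of_hasCompactSupport (HasCompactSupport.of_compactSpace _)
  rw [integral_prod _ hi, key]
  refine intervalIntegral.integral_congr fun s _ => ?_
  exact key _

theorem circleMap_sub_ne {c z : ℂ} {r : ℝ} (hz : z ∈ Metric.ball c r) (s : ℝ) :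
    circleMap c r s - z ≠ 0 :=
  sub_ne_zero.2 (circleMap_ne_mem_ball hz s)

/-- **Osgood's lemma** for two variables. -/
theorem _root_.DifferentiableOn.analyticOnNhd_prod {g : ℂ × ℂ → ℂ} {U : Set (ℂ × ℂ)} (hU : IsOpen U)
    (hg : DifferentiableOn ℂ g U) : AnalyticOnNhd ℂ g U := by
  rintro ⟨a, b⟩ hw
  obtain ⟨r, hr, hrU⟩ : ∃ r > 0, Metric.closedBall a r ×ˢ Metric.closedBall b r ⊆ U := by
    obtain ⟨r, hr, h⟩ := Metric.nhds_basis_closedBall.mem_iff.1 (hU.mem_nhds hw)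
    exact ⟨r, hr, by rwa [closedBall_prod_same]⟩
  let ca : C(AngleInterval × AngleInterval, ℂ) :=
    ⟨fun x => circleMap a r x.1, by fun_prop⟩
  let cb : C(AngleInterval × AngleInterval, ℂ) :=
    ⟨fun x => circleMap b r x.2, by fun_prop⟩
  have hmemC : ∀ (c : ℂ) (s : ℝ), circleMap c r s ∈ Metric.closedBall c r := fun c s =>
    circleMap_mem_closedBall c hr.le s
  let u : C(AngleInterval × AngleInterval, ℂ) :=
    ⟨fun x => (2 * Real.pi * Complex.I)⁻¹ ^ 2 *
        (deriv (circleMap a r) x.1 * deriv (circleMap b r) x.2 *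
          g (circleMap a r x.1, circleMap b r x.2)), by
      refine continuous_const.mul (Continuous.mul ?_ ?_)
      · simp only [deriv_circleMap]; fun_prop
      · refine hg.continuousOn.comp_continuous (by fun_prop) fun x => hrU ⟨hmemC _ _, hmemC _ _⟩⟩
  -- The Cauchy kernel is viewed as a map into a Banach algebra, where inversion is analytic at
  -- units. `Ring.inverse` is `0` at non-units, but `c - z` is a unit for `z` inside the polydisc.
  let κ : C(AngleInterval × AngleInterval, ℂ) → ℂ → C(AngleInterval × AngleInterval, ℂ) :=
    fun c z => Ring.inverse (c - algebraMap ℂ _ z)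
  have hκ : ∀ (c : C(AngleInterval × AngleInterval, ℂ)) (z : ℂ), (∀ x, c x - z ≠ 0) →
      (∀ x, κ c z x = (c x - z)⁻¹) ∧ AnalyticAt ℂ (κ c) z := by
    intro c z h
    have hun : IsUnit (c - algebraMap ℂ C(AngleInterval × AngleInterval, ℂ) z) := by
      rw [ContinuousMap.isUnit_iff_forall_ne_zero]
      intro x
      simpa using h x
    refine ⟨fun x => ?_, ?_⟩
    · have h1 := congrArg (fun f => f x) (Ring.inverse_mul_cancel _ hun)
      simp only [ContinuousMap.mul_apply, ContinuousMap.one_apply, ContinuousMap.sub_apply,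
        algebraMap_apply, smul_eq_mul, mul_one] at h1
      exact eq_inv_of_mul_eq_one_left h1
    · obtain ⟨v, hv⟩ := hun
      have h2 := analyticAt_inverse (𝕜 := ℂ) v
      rw [hv] at h2
      refine AnalyticAt.fun_comp (f := fun z : ℂ => c - algebraMap ℂ _ z) h2 ?_
      have : AnalyticAt ℂ (fun z : ℂ => algebraMap ℂ C(AngleInterval × AngleInterval, ℂ) z) z :=
        (Algebra.linearMap ℂ C(AngleInterval × AngleInterval, ℂ)).toContinuousLinearMap.analyticAt z
      exact analyticAt_const.sub this
  have hform : ∀ z ∈ Metric.ball a r ×ˢ Metric.ball b r,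
      g z = angleIntegral (u * (κ ca z.1 * κ cb z.2)) := by
    rintro ⟨z, w⟩ ⟨hz, hw'⟩
    simp only at hz hw'
    rw [angleIntegral_apply]
    have e1 : g (z, w) = (2 * Real.pi * Complex.I : ℂ)⁻¹ • ∮ ζ in C(a, r), (ζ - z)⁻¹ • g (ζ, w) := by
      refine (DiffContOnCl.two_pi_i_inv_smul_circleIntegral_sub_inv_smul
        (f := fun ζ => g (ζ, w)) (DifferentiableOn.diffContOnCl ?_) hz).symm
      rw [closure_ball _ hr.ne']
      exact hg.comp (by fun_prop) fun ζ hζ => hrU ⟨hζ, Metric.ball_subset_closedBall hw'⟩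
    have e2 : ∀ ζ ∈ Metric.closedBall a r, g (ζ, w) =
        (2 * Real.pi * Complex.I : ℂ)⁻¹ • ∮ η in C(b, r), (η - w)⁻¹ • g (ζ, η) := by
      intro ζ hζ
      refine (DiffContOnCl.two_pi_i_inv_smul_circleIntegral_sub_inv_smul
        (f := fun η => g (ζ, η)) (DifferentiableOn.diffContOnCl ?_) hw').symm
      rw [closure_ball _ hr.ne']
      exact hg.comp (by fun_prop) fun η hη => hrU ⟨hζ, hη⟩
    rw [e1, circleIntegral, ← intervalIntegral.integral_smul]
    refine intervalIntegral.integral_congr fun s hs => ?_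
    rw [Set.uIcc_of_le Real.two_pi_pos.le] at hs
    simp only
    rw [e2 _ (hmemC a s), circleIntegral, ← intervalIntegral.integral_smul,
      ← intervalIntegral.integral_smul, ← intervalIntegral.integral_smul,
      ← intervalIntegral.integral_smul]
    refine intervalIntegral.integral_congr fun t ht => ?_
    rw [Set.uIcc_of_le Real.two_pi_pos.le] at ht
    simp only [Set.projIcc_of_mem _ hs, Set.projIcc_of_mem _ ht, ContinuousMap.mul_apply, smul_eq_mul]
    rw [(hκ ca z fun x => circleMap_sub_ne hz _).1, (hκ cb w fun x => circleMap_sub_ne hw' _).1]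
    simp only [u, ca, cb, ContinuousMap.coe_mk]
    ring
  -- The double Cauchy integral is a continuous linear functional of a product of analytic
  -- algebra-valued maps, so no power series has to be summed by hand.
  have hA : AnalyticAt ℂ (fun z : ℂ × ℂ => angleIntegral (u * (κ ca z.1 * κ cb z.2))) (a, b) := by
    refine AnalyticAt.fun_comp (angleIntegral.analyticAt _) (analyticAt_const.mul (AnalyticAt.mul ?_ ?_))
    · exact AnalyticAt.fun_comp (hκ ca a fun x => circleMap_sub_ne (Metric.mem_ball_self hr) _).2
        analyticAt_fst
    · exact AnalyticAt.fun_comp (hκ cb b fun x => circleMap_sub_ne (Metric.mem_ball_self hr) _).2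
        analyticAt_snd
  refine hA.congr ?_
  have : Metric.ball a r ×ˢ Metric.ball b r ∈ 𝓝 (a, b) :=
    prod_mem_nhds (Metric.ball_mem_nhds a hr) (Metric.ball_mem_nhds b hr)
  filter_upwards [this] with z hz using (hform z hz).symm

/-! ### Holomorphic extensions to strips -/

/-- `f` has a holomorphic extension to `Ω_ρ` that is bounded by `M`. -/
def HasExtension (ρ : ℝ) (f : ℝ × ℝ → ℝ) (M : ℝ) : Prop :=
  ∃ g : ℂ × ℂ → ℂ, DifferentiableOn ℂ g (strip ρ) ∧
    (∀ x : ℝ × ℝ, g ((x.1 : ℂ), (x.2 : ℂ)) = (f x : ℂ)) ∧ ∀ z ∈ strip ρ, ‖g z‖ ≤ M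

theorem isOpen_strip (ρ : ℝ) : IsOpen (strip ρ) :=
  (isOpen_lt (f := fun z : ℂ × ℂ => |z.1.im|) (by fun_prop) continuous_const).inter
    (isOpen_lt (f := fun z : ℂ × ℂ => |z.2.im|) (by fun_prop) continuous_const)

theorem convex_strip (ρ : ℝ) : Convex ℝ (strip ρ) := by
  have h : strip ρ = (fun z : ℂ × ℂ => z.1.im) ⁻¹' Set.Ioo (-ρ) ρ ∩
      (fun z : ℂ × ℂ => z.2.im) ⁻¹' Set.Ioo (-ρ) ρ := by
    ext z
    simp [strip, abs_lt]
  rw [h]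
  exact ((convex_Ioo _ _).is_linear_preimage ⟨fun _ _ => by simp, fun _ _ => by simp⟩).inter
    ((convex_Ioo _ _).is_linear_preimage ⟨fun _ _ => by simp, fun _ _ => by simp⟩)

theorem strip_mono {ρ σ : ℝ} (h : ρ ≤ σ) : strip ρ ⊆ strip σ :=
  fun _ hz => ⟨hz.1.trans_le h, hz.2.trans_le h⟩

theorem ofReal_mem_strip {ρ : ℝ} (hρ : 0 < ρ) (x : ℝ × ℝ) : ((x.1 : ℂ), (x.2 : ℂ)) ∈ strip ρ := by
  simp [strip, hρ]

theorem HasExtension.stripNorm_le {ρ M : ℝ} {f : ℝ × ℝ → ℝ} (h : HasExtension ρ f M) :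
    stripNorm ρ f ≤ ENNReal.ofReal M := by
  obtain ⟨g, hg, hgf, hM⟩ := h
  refine iInf_le_of_le g (iInf_le_of_le hg (iInf_le_of_le hgf (iSup₂_le fun z hz => ?_)))
  rw [← ofReal_norm]
  exact ENNReal.ofReal_le_ofReal (hM z hz)

theorem hasExtension_of_stripNorm_lt {ρ M : ℝ} {f : ℝ × ℝ → ℝ}
    (h : stripNorm ρ f < ENNReal.ofReal M) : HasExtension ρ f M := by
  simp only [stripNorm, iInf_lt_iff] at h
  obtain ⟨g, hg, hgf, hM⟩ := h
  refine ⟨g, hg, hgf, fun z hz => ?_⟩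
  have h1 : ENNReal.ofReal ‖g z‖ < ENNReal.ofReal M := by
    rw [ofReal_norm]
    exact (le_iSup₂ (f := fun z (_ : z ∈ strip ρ) => ‖g z‖ₑ) z hz).trans_lt hM
  exact (ENNReal.lt_ofReal_iff_toReal_lt (by simp)).1 h1 |>.le.trans' (by simp)

theorem HasExtension.mono {ρ σ M : ℝ} {f : ℝ × ℝ → ℝ} (h : HasExtension σ f M) (hρ : ρ ≤ σ) :
    HasExtension ρ f M := by
  obtain ⟨g, hg, hgf, hM⟩ := h
  exact ⟨g, hg.mono (strip_mono hρ), hgf, fun z hz => hM z (strip_mono hρ hz)⟩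

theorem HasExtension.add {ρ M N : ℝ} {f f' : ℝ × ℝ → ℝ} (h : HasExtension ρ f M)
    (h' : HasExtension ρ f' N) : HasExtension ρ (fun x => f x + f' x) (M + N) := by
  obtain ⟨g, hg, hgf, hM⟩ := h
  obtain ⟨g', hg', hgf', hN⟩ := h'
  refine ⟨fun z => g z + g' z, hg.add hg', fun x => by simp [hgf, hgf'], fun z hz => ?_⟩
  exact (norm_add_le _ _).trans (add_le_add (hM z hz) (hN z hz))

theorem HasExtension.neg {ρ M : ℝ} {f : ℝ × ℝ → ℝ} (h : HasExtension ρ f M) :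
    HasExtension ρ (fun x => -f x) M := by
  obtain ⟨g, hg, hgf, hM⟩ := h
  exact ⟨fun z => -g z, hg.neg, fun x => by simp [hgf], fun z hz => by simpa using hM z hz⟩

theorem hasExtension_const (ρ c : ℝ) : HasExtension ρ (fun _ => c) |c| :=
  ⟨fun _ => c, by fun_prop, fun _ => rfl, fun z _ => by simp⟩

theorem HasExtension.abs_le {ρ M : ℝ} {f : ℝ × ℝ → ℝ} (hρ : 0 < ρ) (h : HasExtension ρ f M)
    (x : ℝ × ℝ) : |f x| ≤ M := by
  obtain ⟨g, hg, hgf, hM⟩ := h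
  have := hM _ (ofReal_mem_strip hρ x)
  rwa [hgf, Complex.norm_real] at this

theorem HasExtension.analyticOnNhd {ρ M : ℝ} {f : ℝ × ℝ → ℝ} (hρ : 0 < ρ)
    (h : HasExtension ρ f M) : AnalyticOnNhd ℝ f Set.univ := by
  obtain ⟨g, hg, hgf, hM⟩ := h
  intro x _
  have h1 := (hg.analyticOnNhd_prod (isOpen_strip ρ) _ (ofReal_mem_strip hρ x)).restrictScalars (𝕜 := ℝ)
  have h2 : AnalyticAt ℝ (fun x : ℝ × ℝ => ((x.1 : ℂ), (x.2 : ℂ))) x :=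
    ((Complex.ofRealCLM.comp (ContinuousLinearMap.fst ℝ ℝ ℝ)).prod
      (Complex.ofRealCLM.comp (ContinuousLinearMap.snd ℝ ℝ ℝ))).analyticAt x
  have h3 : f = fun x => Complex.reCLM (g ((x.1 : ℂ), (x.2 : ℂ))) := by
    ext x
    simp [hgf]
  rw [h3]
  exact AnalyticAt.fun_comp (Complex.reCLM.analyticAt _) (AnalyticAt.fun_comp (g := g) h1 h2)

/-- Cauchy's estimate for the derivative. -/
theorem norm_fderiv_le_of_strip {ρ M : ℝ} {g : ℂ × ℂ → ℂ} (hg : DifferentiableOn ℂ g (strip (ρ + 1)))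
    (hM : ∀ z ∈ strip (ρ + 1), ‖g z‖ ≤ M) {z : ℂ × ℂ} (hz : z ∈ strip ρ) :
    ‖fderiv ℂ g z‖ ≤ M := by
  have hz' : z ∈ strip (ρ + 1) := strip_mono (by linarith) hz
  have hM0 : 0 ≤ M := (norm_nonneg _).trans (hM z hz')
  refine ContinuousLinearMap.opNorm_le_bound _ hM0 fun v => ?_
  rcases eq_or_ne v 0 with rfl | hv
  · simp
  have hv' : 0 < ‖v‖ := norm_pos_iff.2 hv
  -- On the complex line through `z` in direction `v`, radius `‖v‖⁻¹` moves the point by at most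
  -- `1`, the room between the two strips.
  have hmem : ∀ ζ ∈ Metric.closedBall (0 : ℂ) ‖v‖⁻¹, z + ζ • v ∈ strip (ρ + 1) := by
    intro ζ hζ
    have h1 : ‖ζ • v‖ ≤ 1 := by
      rw [norm_smul]
      calc ‖ζ‖ * ‖v‖ ≤ ‖v‖⁻¹ * ‖v‖ := by gcongr; simpa using hζ
        _ = 1 := inv_mul_cancel₀ hv'.ne'
    have h2 := (Complex.abs_im_le_norm (ζ • v).1).trans ((norm_fst_le _).trans h1)
    have h3 := (Complex.abs_im_le_norm (ζ • v).2).trans ((norm_snd_le _).trans h1)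
    refine ⟨?_, ?_⟩
    · rw [Prod.fst_add, Complex.add_im]
      exact (abs_add_le _ _).trans_lt (add_lt_add_of_lt_of_le hz.1 h2)
    · rw [Prod.snd_add, Complex.add_im]
      exact (abs_add_le _ _).trans_lt (add_lt_add_of_lt_of_le hz.2 h3)
  have hd : DifferentiableAt ℂ g (z + (0 : ℂ) • v) := by
    simpa using (hg z hz').differentiableAt ((isOpen_strip _).mem_nhds hz')
  have hder : deriv (fun ζ : ℂ => g (z + ζ • v)) 0 = fderiv ℂ g z v := by
    have h1 : HasDerivAt (fun ζ : ℂ => z + ζ • v) v 0 := by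
      simpa using ((hasDerivAt_id (0 : ℂ)).smul_const v).const_add z
    have := (hd.hasFDerivAt.comp_hasDerivAt (0 : ℂ) h1).deriv
    simpa [Function.comp_def] using this
  rw [← hder]
  have := Complex.norm_deriv_le_of_forall_mem_sphere_norm_le (f := fun ζ : ℂ => g (z + ζ • v))
    (c := 0) (C := M) (inv_pos.2 hv') (DifferentiableOn.diffContOnCl ?_)
    (fun ζ hζ => hM _ (hmem ζ (Metric.sphere_subset_closedBall hζ)))
  · simpa [div_inv_eq_mul] using this
  · rw [closure_ball _ (inv_pos.2 hv').ne']
    exact hg.comp (by fun_prop) hmem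

/-- Termwise differentiation needs a summable bound on the derivatives; Cauchy's estimate supplies
it at the cost of `1` in the width of the strip. -/
theorem hasExtension_tsum {ρ : ℝ} {e : ℕ → ℝ × ℝ → ℝ} {η : ℕ → ℝ} (hη : Summable η)
    (h : ∀ n, HasExtension (ρ + 1) (e n) (η n)) :
    HasExtension ρ (fun x => ∑' n, e n x) (∑' n, η n) := by
  choose g hg hge hM using h
  have hs : strip ρ ⊆ strip (ρ + 1) := strip_mono (by linarith)
  have hsum : ∀ z ∈ strip (ρ + 1), Summable fun n => g n z := fun z hz =>
    Summable.of_norm_bounded hη fun n => hM n z hz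
  refine ⟨fun z => ∑' n, g n z, fun z hz => ?_, fun x => ?_, fun z hz => ?_⟩
  · refine (hasFDerivAt_tsum_of_isPreconnected (f' := fun n z => fderiv ℂ (g n) z) hη
      (isOpen_strip ρ) (convex_strip ρ).isPreconnected (fun n y hy => ?_)
      (fun n y hy => norm_fderiv_le_of_strip (hg n) (hM n) hy) hz (hsum z (hs hz))
      hz).differentiableAt.differentiableWithinAt
    exact ((hg n y (hs hy)).differentiableAt ((isOpen_strip _).mem_nhds (hs hy))).hasFDerivAt
  · rw [Complex.ofReal_tsum]
    exact tsum_congr fun n => hge n x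
  · exact tsum_of_norm_bounded hη.hasSum fun n => hM n z (hs hz)

/-! ### Displacements -/

theorem circle_coe_eq_coe_iff {a b : ℝ} : (a : UnitAddCircle) = b ↔ ∃ m : ℤ, a = b + m := by
  rw [← sub_eq_zero, ← AddCircle.coe_sub, AddCircle.coe_eq_zero_iff]
  refine exists_congr fun m => ?_
  rw [zsmul_one, eq_sub_iff_add_eq, add_comm b, eq_comm]

theorem proj_eq_proj_iff {x y : ℝ × ℝ} :
    proj x = proj y ↔ ∃ m n : ℤ, x = (y.1 + m, y.2 + n) := by
  simp only [proj, Prod.ext_iff, circle_coe_eq_coe_iff]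
  exact ⟨fun ⟨⟨m, hm⟩, n, hn⟩ => ⟨m, n, hm, hn⟩, fun ⟨m, n, hm, hn⟩ => ⟨⟨m, hm⟩, n, hn⟩⟩

theorem proj_surjective (u : Torus) : ∃ x, proj x = u := by
  obtain ⟨a, ha⟩ := QuotientAddGroup.mk_surjective u.1
  obtain ⟨b, hb⟩ := QuotientAddGroup.mk_surjective u.2
  exact ⟨(a, b), Prod.ext ha hb⟩

theorem continuous_proj : Continuous proj :=
  ((AddCircle.continuous_mk' 1).comp continuous_fst).prodMk
    ((AddCircle.continuous_mk' 1).comp continuous_snd)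

theorem dist_circle_coe_le (a b : ℝ) : dist (a : UnitAddCircle) b ≤ |a - b| := by
  rw [dist_eq_norm, ← AddCircle.coe_sub]
  exact QuotientAddGroup.norm_mk_le_norm

theorem dist_proj_le (x y : ℝ × ℝ) : dist (proj x) (proj y) ≤ dist x y :=
  max_le_max (dist_circle_coe_le _ _) (dist_circle_coe_le _ _)

/-- A continuous function with integer values on a preconnected space is constant. -/
theorem exists_int_of_forall_exists_int {X : Type*} [TopologicalSpace X] [PreconnectedSpace X]
    [Nonempty X] {d : X → ℝ} (hd : Continuous d) (h : ∀ x, ∃ m : ℤ, d x = m) :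
    ∃ m : ℤ, ∀ x, d x = m := by
  choose m hm using h
  have hc : Continuous m := by
    rw [Int.isClosedEmbedding_coe_real.isEmbedding.continuous_iff]
    have : (fun n : ℤ => (n : ℝ)) ∘ m = d := funext fun x => (hm x).symm
    rwa [this]
  obtain ⟨x₀⟩ := ‹Nonempty X›
  exact ⟨m x₀, fun x => by rw [hm x, PreconnectedSpace.constant ‹_› hc (y := x₀)]⟩

theorem IsDisplacement.eq_add_int {T : Torus → Torus} {f g : Fin 2 → ℝ × ℝ → ℝ}
    (hf : IsDisplacement T f) (hg : IsDisplacement T g) (i : Fin 2) :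
    ∃ m : ℤ, ∀ x, f i x = g i x + m := by
  have key : ∃ m : ℤ, ∀ x, f i x - g i x = m := by
    refine exists_int_of_forall_exists_int ((hf.continuous i).sub (hg.continuous i)) fun x => ?_
    obtain ⟨m, n, h⟩ := proj_eq_proj_iff.1 ((hf.lift x).symm.trans (hg.lift x))
    have h1 := congrArg Prod.fst h
    have h2 := congrArg Prod.snd h
    simp only at h1 h2
    fin_cases i
    · exact ⟨m, by simp only [Fin.zero_eta]; linarith⟩
    · exact ⟨n, by simp only [Fin.mk_one]; linarith⟩
  obtain ⟨m, hm⟩ := key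
  exact ⟨m, fun x => by linarith [hm x]⟩

theorem IsDisplacement.add_int {T : Torus → Torus} {f : Fin 2 → ℝ × ℝ → ℝ}
    (hf : IsDisplacement T f) (m : Fin 2 → ℤ) :
    IsDisplacement T (fun i x => f i x + m i) where
  continuous i := (hf.continuous i).add continuous_const
  periodic i x a b := by simp only [hf.periodic i x a b]
  lift x := by
    rw [hf.lift x, proj_eq_proj_iff]
    exact ⟨-m 0, -m 1, by ext <;> push_cast <;> ring⟩

/-- The map of the torus with given continuous periodic displacement. -/
theorem exists_isDisplacement {f : Fin 2 → ℝ × ℝ → ℝ} (hc : ∀ i, Continuous (f i))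
    (hp : ∀ i, IsPeriodic (f i)) : ∃ T : Torus → Torus, IsDisplacement T f := by
  choose s hs using proj_surjective
  refine ⟨fun u => proj ((s u).1 + f 0 (s u), (s u).2 + f 1 (s u)), hc, hp, fun x => ?_⟩
  obtain ⟨m, n, h⟩ := proj_eq_proj_iff.1 (hs (proj x))
  rw [h, hp 0, hp 1, proj_eq_proj_iff]
  exact ⟨m, n, by ext <;> ring⟩

/-- All displacements have bounded extensions to all strips. -/
def HasTameDisplacement (T : Torus → Torus) : Prop :=
  ∃ f, IsDisplacement T f ∧ ∀ i ρ, ∃ M, HasExtension ρ (f i) M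

theorem HasTameDisplacement.hasExtension {T : Torus → Torus} (h : HasTameDisplacement T)
    {f : Fin 2 → ℝ × ℝ → ℝ} (hf : IsDisplacement T f) (i : Fin 2) (ρ : ℝ) :
    ∃ M, HasExtension ρ (f i) M := by
  obtain ⟨g, hg, hM⟩ := h
  obtain ⟨m, hm⟩ := hf.eq_add_int hg i
  obtain ⟨M, hM⟩ := hM i ρ
  rw [funext hm]
  exact ⟨_, hM.add (hasExtension_const ρ m)⟩

theorem IsDisplacement.memAnalytic {T : Torus → Torus} {f : Fin 2 → ℝ × ℝ → ℝ}
    (hf : IsDisplacement T f) {i : Fin 2} {ρ M : ℝ} (hρ : 0 < ρ) (h : HasExtension ρ (f i) M) :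
    MemAnalytic ρ (f i) :=
  ⟨hf.periodic i, h.analyticOnNhd hρ, h.stripNorm_le.trans_lt ENNReal.ofReal_lt_top⟩

theorem analyticDist_le {T S : Torus → Torus} {f g : Fin 2 → ℝ × ℝ → ℝ} (hf : IsDisplacement T f)
    (hg : IsDisplacement S g) {ρ M : ℝ} (h : ∀ i, HasExtension ρ (fun x => f i x - g i x) M) :
    analyticDist ρ T S ≤ ENNReal.ofReal M := by
  refine iInf_le_of_le f (iInf_le_of_le g (iInf_le_of_le hf (iInf_le_of_le hg (iSup_le fun i =>
    iInf_le_of_le 0 ?_))))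
  simpa using (h i).stripNorm_le

/-- The metric ignores integer constants. Here they are absorbed into the displacement of `S`, so
that consecutive displacements of a sequence can be chosen to match and then telescoped. -/
theorem exists_isDisplacement_of_analyticDist_lt {T S : Torus → Torus} {ρ M : ℝ}
    (h : analyticDist ρ T S < ENNReal.ofReal M) {f : Fin 2 → ℝ × ℝ → ℝ} (hf : IsDisplacement T f) :
    ∃ g, IsDisplacement S g ∧ ∀ i, HasExtension ρ (fun x => g i x - f i x) M := by
  simp only [analyticDist, iInf_lt_iff] at h
  obtain ⟨f', g', hf', hg', h⟩ := h
  have h1 : ∀ i, ∃ m : ℤ, HasExtension ρ (fun x => f' i x - g' i x + m) M := by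
    intro i
    obtain ⟨m, hm⟩ := iInf_lt_iff.1 ((le_iSup (fun i => ⨅ m : ℤ,
      stripNorm ρ (fun x => f' i x - g' i x + m)) i).trans_lt h)
    exact ⟨m, hasExtension_of_stripNorm_lt hm⟩
  choose m hm using h1
  choose a ha using fun i => hf.eq_add_int hf' i
  refine ⟨_, hg'.add_int (fun i => a i - m i), fun i => ?_⟩
  convert (hm i).neg using 2 with x
  rw [ha i x]
  push_cast
  ring

/-- The strips widen with `n`, so for a fixed `ρ` all but finitely many increments extend to the
strip of width `ρ + 1`. The limit is the sum of the telescoping series of displacements; on `ℝ²`,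
which lies in every strip, all increments count, whence the uniform bound from every `n` on. -/
theorem exists_limit {S : ℕ → Torus → Torus} {η : ℕ → ℝ} (hη : Summable η)
    (hS : ∀ n, HasTameDisplacement (S n))
    (hd : ∀ n : ℕ, analyticDist (n + 1) (S n) (S (n + 1)) < ENNReal.ofReal (η n)) :
    ∃ (S' : Torus → Torus) (f : Fin 2 → ℝ × ℝ → ℝ), IsDisplacement S' f ∧
      (∀ ρ : ℝ, 0 < ρ → ∀ i, MemAnalytic ρ (f i)) ∧
      (∀ ρ : ℝ, 0 < ρ → Tendsto (fun n => analyticDist ρ (S n) S') atTop (𝓝 0)) ∧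
      ∀ n u, dist (S n u) (S' u) ≤ ∑' m, η (m + n) := by
  obtain ⟨f₀, hf₀, -⟩ := hS 0
  choose g hg hgf using fun (n : ℕ) (f : {f // IsDisplacement (S n) f}) =>
    exists_isDisplacement_of_analyticDist_lt (hd n) f.2
  let φ : (n : ℕ) → {f // IsDisplacement (S n) f} := fun n =>
    Nat.rec (motive := fun n => {f // IsDisplacement (S n) f}) ⟨f₀, hf₀⟩ (fun n f => ⟨g n f, hg n f⟩) n
  let F : ℕ → Fin 2 → ℝ × ℝ → ℝ := fun n => (φ n).1
  have hF : ∀ n, IsDisplacement (S n) (F n) := fun n => (φ n).2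
  have hE : ∀ (n : ℕ) i, HasExtension (n + 1) (fun x => F (n + 1) i x - F n i x) (η n) := fun n i =>
    hgf n (φ n) i
  have hEb : ∀ i x n, |F (n + 1) i x - F n i x| ≤ η n := fun i x n =>
    (hE n i).abs_le (by positivity) x
  have hsumE : ∀ i x, Summable fun n => F (n + 1) i x - F n i x := fun i x =>
    Summable.of_norm_bounded hη fun n => hEb i x n
  let f : Fin 2 → ℝ × ℝ → ℝ := fun i x => F 0 i x + ∑' n, (F (n + 1) i x - F n i x)
  have hfN : ∀ N i x, f i x - F N i x = ∑' n, (F (n + N + 1) i x - F (n + N) i x) := by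
    intro N i x
    have h1 := (hsumE i x).sum_add_tsum_nat_add N
    rw [Finset.sum_range_sub (fun n => F n i x)] at h1
    simp only [f]
    linarith
  have htail : ∀ (ρ : ℝ), 0 < ρ → ∀ N : ℕ, ρ ≤ N → ∀ i,
      HasExtension ρ (fun x => f i x - F N i x) (∑' n, η (n + N)) := by
    intro ρ hρ N hN i
    simp only [hfN N i]
    -- The increment of index `n + N` extends to width `n + N + 1 ≥ ρ + 1`, which pays for the loss
    -- in `hasExtension_tsum`.
    refine hasExtension_tsum ((summable_nat_add_iff N).2 hη) fun n => ?_
    have := hE (n + N) i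
    push_cast at this
    exact this.mono (by linarith [n.cast_nonneg (α := ℝ)])
  have hext : ∀ (ρ : ℝ), 0 < ρ → ∀ i, ∃ M, HasExtension ρ (f i) M := by
    intro ρ hρ i
    obtain ⟨N, hN⟩ := exists_nat_ge ρ
    obtain ⟨M, hM⟩ := (hS N).hasExtension (hF N) i ρ
    have := (htail ρ hρ N hN i).add hM
    simp only [sub_add_cancel] at this
    exact ⟨_, this⟩
  have hfc : ∀ i, Continuous (f i) := by
    intro i
    obtain ⟨M, hM⟩ := hext 1 one_pos i
    exact continuousOn_univ.1 (hM.analyticOnNhd one_pos).continuousOn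
  have hfp : ∀ i, IsPeriodic (f i) := by
    intro i x m n
    simp only [f, fun k => (hF k).periodic i x m n]
  obtain ⟨S', hS'⟩ := exists_isDisplacement hfc hfp
  refine ⟨S', f, hS', fun ρ hρ i => ?_, fun ρ hρ => ?_, fun n u => ?_⟩
  · obtain ⟨M, hM⟩ := hext ρ hρ i
    exact hS'.memAnalytic hρ hM
  · have h0 : Tendsto (fun n => ENNReal.ofReal (∑' m, η (m + n))) atTop (𝓝 0) := by
      have := ENNReal.tendsto_ofReal (tendsto_sum_nat_add η)
      rwa [ENNReal.ofReal_zero] at this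
    refine tendsto_of_tendsto_of_tendsto_of_le_of_le' tendsto_const_nhds h0
      (Eventually.of_forall fun _ => zero_le) ?_
    obtain ⟨N, hN⟩ := exists_nat_ge ρ
    filter_upwards [eventually_ge_atTop N] with n hn
    refine analyticDist_le (hF n) hS' fun i => ?_
    have := (htail ρ hρ n (hN.trans (by exact_mod_cast hn)) i).neg
    simpa using this
  · obtain ⟨x, rfl⟩ := proj_surjective u
    rw [(hF n).lift, hS'.lift]
    have hb : ∀ i, |F n i x - f i x| ≤ ∑' m, η (m + n) := by
      intro i
      rw [abs_sub_comm, hfN]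
      exact tsum_of_norm_bounded (f := fun m => F (m + n + 1) i x - F (m + n) i x)
        ((summable_nat_add_iff n).2 hη).hasSum fun m => hEb i x (m + n)
    refine (dist_proj_le _ _).trans (max_le ?_ ?_)
    · simpa [Real.dist_eq] using hb 0
    · simpa [Real.dist_eq] using hb 1

/-! ### Entire lifts -/

/-- The inclusion `ℝ² → ℂ²`. -/
def emb (x : ℝ × ℝ) : ℂ × ℂ := ((x.1 : ℂ), (x.2 : ℂ))

/-- The inclusion `ℤ² → ℝ²`. -/
def intVec (m : ℤ × ℤ) : ℝ × ℝ := ((m.1 : ℝ), (m.2 : ℝ))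

theorem emb_injective : Function.Injective emb := fun x y h => by
  simpa [emb, Prod.ext_iff] using h

theorem emb_add (x y : ℝ × ℝ) : emb (x + y) = emb x + emb y := by simp [emb]

theorem isPeriodic_iff {f : ℝ × ℝ → ℝ} : IsPeriodic f ↔ ∀ x m, f (x + intVec m) = f x :=
  ⟨fun h x m => h x m.1 m.2, fun h x m n => h x (m, n)⟩

/-- The Jacobian determinant of a linear map of the plane. -/
def jac (L : ℝ × ℝ →L[ℝ] ℝ × ℝ) : ℝ :=
  (L (1, 0)).1 * (L (0, 1)).2 - (L (1, 0)).2 * (L (0, 1)).1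

theorem apply_eq_basis (L : ℝ × ℝ →L[ℝ] ℝ × ℝ) (v : ℝ × ℝ) :
    L v = v.1 • L (1, 0) + v.2 • L (0, 1) := by
  rw [← map_smul, ← map_smul, ← map_add]
  simp

theorem jac_comp (L M : ℝ × ℝ →L[ℝ] ℝ × ℝ) : jac (L.comp M) = jac L * jac M := by
  simp only [jac, ContinuousLinearMap.comp_apply]
  rw [apply_eq_basis L (M (1, 0)), apply_eq_basis L (M (0, 1))]
  simp only [Prod.fst_add, Prod.snd_add, Prod.smul_fst, Prod.smul_snd, smul_eq_mul]
  ring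

theorem norm_apply_le_of_basis {L : ℝ × ℝ →L[ℝ] ℝ × ℝ} {D : ℝ} (h1 : ‖L (1, 0)‖ ≤ D)
    (h2 : ‖L (0, 1)‖ ≤ D) : ‖L‖ ≤ 2 * D := by
  have hD : 0 ≤ D := (norm_nonneg _).trans h1
  refine ContinuousLinearMap.opNorm_le_bound _ (by positivity) fun v => ?_
  rw [apply_eq_basis L v]
  calc ‖v.1 • L (1, 0) + v.2 • L (0, 1)‖ ≤ ‖v.1‖ * ‖L (1, 0)‖ + ‖v.2‖ * ‖L (0, 1)‖ := by
        rw [← norm_smul, ← norm_smul]; exact norm_add_le _ _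
    _ ≤ ‖v‖ * D + ‖v‖ * D := by
        gcongr
        · exact norm_fst_le v
        · exact norm_snd_le v
    _ = 2 * D * ‖v‖ := by ring

/-- A left inverse of an area preserving linear map of the plane has the same entries up to order
and sign. -/
theorem norm_apply_le_of_comp_eq_id {L M : ℝ × ℝ →L[ℝ] ℝ × ℝ} {D : ℝ} (hL : jac L = 1)
    (hML : ∀ v, M (L v) = v) (h1 : ‖L (1, 0)‖ ≤ D) (h2 : ‖L (0, 1)‖ ≤ D) :
    ‖M (1, 0)‖ ≤ D ∧ ‖M (0, 1)‖ ≤ D := by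
  obtain ⟨a1, a2⟩ := max_le_iff.1 h1
  obtain ⟨b1, b2⟩ := max_le_iff.1 h2
  -- With determinant `1` the adjugate of `L` is a right inverse, so the left inverse `M` coincides
  -- with it.
  have e1 : M (1, 0) = ((L (0, 1)).2, -(L (1, 0)).2) := by
    rw [← hML ((L (0, 1)).2, -(L (1, 0)).2), apply_eq_basis L]
    congr 1
    simp only [jac] at hL
    ext
    · simp only [Prod.fst_add, Prod.smul_fst, smul_eq_mul]; linarith
    · simp only [Prod.snd_add, Prod.smul_snd, smul_eq_mul]; ring
  have e2 : M (0, 1) = (-(L (0, 1)).1, (L (1, 0)).1) := by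
    rw [← hML (-(L (0, 1)).1, (L (1, 0)).1), apply_eq_basis L]
    congr 1
    simp only [jac] at hL
    ext
    · simp only [Prod.fst_add, Prod.smul_fst, smul_eq_mul]; ring
    · simp only [Prod.snd_add, Prod.smul_snd, smul_eq_mul]; linarith
  rw [e1, e2]
  refine ⟨max_le b2 ?_, max_le ?_ a1⟩
  · simpa using a2
  · simpa using b1

/-- `F` is a lift of `H` with Jacobian `1` and entire extension `G`, which is equivariant under the
map `A` of `ℤ²`. -/
structure IsEntireLift (H : Torus → Torus) (F : ℝ × ℝ → ℝ × ℝ) (G : ℂ × ℂ → ℂ × ℂ)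
    (A : ℤ × ℤ → ℤ × ℤ) : Prop where
  differentiable : Differentiable ℂ G
  extends_real : ∀ x, G (emb x) = emb (F x)
  lift : ∀ x, proj (F x) = H (proj x)
  equivariant : ∀ z m, G (z + emb (intVec m)) = G z + emb (intVec (A m))
  jac_eq_one : ∀ x, jac (fderiv ℝ F x) = 1

namespace IsEntireLift

variable {H H₁ H₂ : Torus → Torus} {F F₁ F₂ : ℝ × ℝ → ℝ × ℝ} {G G₁ G₂ : ℂ × ℂ → ℂ × ℂ}
  {A A₁ A₂ : ℤ × ℤ → ℤ × ℤ}

theorem analytic (h : IsEntireLift H F G A) : AnalyticOnNhd ℝ F Set.univ := by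
  have key : ∀ (g : ℂ × ℂ → ℂ), Differentiable ℂ g →
      AnalyticOnNhd ℝ (fun x => (g (emb x)).re) Set.univ := by
    intro g hg x _
    have h1 := (hg.differentiableOn.analyticOnNhd_prod isOpen_univ (emb x) trivial).restrictScalars
      (𝕜 := ℝ)
    have h2 : AnalyticAt ℝ emb x :=
      ((Complex.ofRealCLM.comp (ContinuousLinearMap.fst ℝ ℝ ℝ)).prod
        (Complex.ofRealCLM.comp (ContinuousLinearMap.snd ℝ ℝ ℝ))).analyticAt x
    exact AnalyticAt.fun_comp (Complex.reCLM.analyticAt _) (AnalyticAt.fun_comp (g := g) h1 h2)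
  have h3 : F = fun x => ((G (emb x)).1.re, (G (emb x)).2.re) := by
    ext x <;> rw [h.extends_real] <;> simp [emb]
  rw [h3]
  exact (key _ h.differentiable.fst).prod (key _ h.differentiable.snd)

theorem isAnalyticLift (h : IsEntireLift H F G A) : IsAnalyticLift H F := ⟨h.analytic, h.lift⟩

theorem real_equivariant (h : IsEntireLift H F G A) (x : ℝ × ℝ) (m : ℤ × ℤ) :
    F (x + intVec m) = F x + intVec (A m) := by
  apply emb_injective
  rw [← h.extends_real, emb_add, h.equivariant, emb_add, h.extends_real]

theorem differentiable_real (h : IsEntireLift H F G A) : Differentiable ℝ F := fun x =>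
  (h.analytic x trivial).differentiableAt

theorem continuous (h : IsEntireLift H F G A) : Continuous F := h.differentiable_real.continuous

theorem comp (h₂ : IsEntireLift H₂ F₂ G₂ A₂) (h₁ : IsEntireLift H₁ F₁ G₁ A₁) :
    IsEntireLift (H₂ ∘ H₁) (F₂ ∘ F₁) (G₂ ∘ G₁) (A₂ ∘ A₁) where
  differentiable := h₂.differentiable.comp h₁.differentiable
  extends_real x := by simp only [Function.comp_apply, h₁.extends_real, h₂.extends_real]
  lift x := by simp only [Function.comp_apply, h₁.lift, h₂.lift]
  equivariant z m := by simp only [Function.comp_apply, h₁.equivariant, h₂.equivariant]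
  jac_eq_one x := by
    rw [fderiv_comp x (h₂.differentiable_real _) (h₁.differentiable_real _), jac_comp,
      h₁.jac_eq_one, h₂.jac_eq_one, one_mul]

theorem fderiv_add_intVec (h : IsEntireLift H F G A) (x : ℝ × ℝ) (m : ℤ × ℤ) :
    fderiv ℝ F (x + intVec m) = fderiv ℝ F x := by
  rw [← fderiv_comp_add_right, funext fun y => h.real_equivariant y m, fderiv_add_const]

theorem exists_fderiv_bound (h : IsEntireLift H F G A) : ∃ D : ℝ, ∀ x, ‖fderiv ℝ F x‖ ≤ D := by
  have hc : Continuous fun x => fderiv ℝ F x := continuousOn_univ.1 h.analytic.fderiv.continuousOn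
  obtain ⟨D, hD⟩ := (isCompact_Icc (a := (0 : ℝ × ℝ)) (b := 1)).exists_bound_of_continuousOn
    hc.continuousOn
  refine ⟨D, fun x => ?_⟩
  rw [← h.fderiv_add_intVec x (-⌊x.1⌋, -⌊x.2⌋)]
  have e : x + intVec (-⌊x.1⌋, -⌊x.2⌋) = (Int.fract x.1, Int.fract x.2) := by
    ext <;> simp [intVec, Int.fract, sub_eq_add_neg]
  rw [e]
  exact hD _ ⟨⟨Int.fract_nonneg _, Int.fract_nonneg _⟩,
    ⟨(Int.fract_lt_one _).le, (Int.fract_lt_one _).le⟩⟩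

theorem derivSup_lt_top (h : IsEntireLift H F G A) : derivSup H < ∞ := by
  obtain ⟨D, hD⟩ := h.exists_fderiv_bound
  have hb : ∀ x (v : ℝ × ℝ), ‖v‖ ≤ 1 → ‖fderiv ℝ F x v‖ₑ ≤ ENNReal.ofReal D := by
    intro x v hv
    rw [← ofReal_norm]
    refine ENNReal.ofReal_le_ofReal ?_
    calc ‖fderiv ℝ F x v‖ ≤ ‖fderiv ℝ F x‖ * ‖v‖ := ContinuousLinearMap.le_opNorm _ _
      _ ≤ ‖fderiv ℝ F x‖ * 1 := by gcongr
      _ ≤ D := by rw [mul_one]; exact hD x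
  refine (iInf₂_le F h.isAnalyticLift).trans_lt (lt_of_le_of_lt (iSup_le fun x =>
    max_le (hb x _ ?_) (hb x _ ?_)) (ENNReal.ofReal_lt_top (r := D)))
  · simp [Prod.norm_def]
  · simp [Prod.norm_def]

/-- Any two continuous lifts differ by a constant integer vector and so have the same derivative;
every term of the infimum is therefore computed by `F`. -/
theorem enorm_fderiv_le_derivSup (h : IsEntireLift H F G A) (x : ℝ × ℝ) :
    max ‖fderiv ℝ F x (1, 0)‖ₑ ‖fderiv ℝ F x (0, 1)‖ₑ ≤ derivSup H := by
  refine le_iInf₂ fun F' hF' => ?_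
  have hc : ∀ x, proj (F x) = proj (F' x) := fun x => (h.lift x).trans (hF'.lift x).symm
  have hF'd : Continuous F' := continuousOn_univ.1 hF'.analytic.continuousOn
  obtain ⟨m, hm⟩ : ∃ m : ℤ, ∀ x, (F x).1 - (F' x).1 = m :=
    exists_int_of_forall_exists_int (h.continuous.fst.sub hF'd.fst) fun x => by
      obtain ⟨m, n, hmn⟩ := proj_eq_proj_iff.1 (hc x)
      exact ⟨m, by rw [hmn]; ring⟩
  obtain ⟨n, hn⟩ : ∃ n : ℤ, ∀ x, (F x).2 - (F' x).2 = n :=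
    exists_int_of_forall_exists_int (h.continuous.snd.sub hF'd.snd) fun x => by
      obtain ⟨m, n, hmn⟩ := proj_eq_proj_iff.1 (hc x)
      exact ⟨n, by rw [hmn]; ring⟩
  have e : F = fun x => F' x + intVec (m, n) := by
    ext x
    · simp only [intVec, Prod.fst_add]; linarith [hm x]
    · simp only [intVec, Prod.snd_add]; linarith [hn x]
  rw [e, fderiv_add_const]
  exact le_iSup (fun x => max ‖fderiv ℝ F' x (1, 0)‖ₑ ‖fderiv ℝ F' x (0, 1)‖ₑ) x

end IsEntireLift

theorem exists_dist_le_of_circle (u v : UnitAddCircle) :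
    ∃ a b : ℝ, (a : UnitAddCircle) = u ∧ (b : UnitAddCircle) = v ∧ |a - b| ≤ dist u v := by
  obtain ⟨a, rfl⟩ := QuotientAddGroup.mk_surjective u
  obtain ⟨b, rfl⟩ := QuotientAddGroup.mk_surjective v
  refine ⟨a - round (a - b), b, ?_, rfl, ?_⟩
  · exact circle_coe_eq_coe_iff.2 ⟨-round (a - b), by push_cast; ring⟩
  · rw [dist_eq_norm]
    have : ‖((a - b : ℝ) : UnitAddCircle)‖ = |a - b - round (a - b)| := UnitAddCircle.norm_eq
    rw [AddCircle.coe_sub] at this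
    refine le_of_eq ?_
    rw [show a - round (a - b) - b = a - b - round (a - b) by ring]
    exact this.symm

theorem exists_dist_le_of_torus (u v : Torus) :
    ∃ x y, proj x = u ∧ proj y = v ∧ dist x y ≤ dist u v := by
  obtain ⟨a, b, ha, hb, hab⟩ := exists_dist_le_of_circle u.1 v.1
  obtain ⟨c, d, hc, hd, hcd⟩ := exists_dist_le_of_circle u.2 v.2
  exact ⟨(a, c), (b, d), Prod.ext ha hc, Prod.ext hb hd, max_le_max hab hcd⟩

theorem IsEntireLift.dist_le {H : Torus → Torus} {F : ℝ × ℝ → ℝ × ℝ} {G : ℂ × ℂ → ℂ × ℂ}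
    {A : ℤ × ℤ → ℤ × ℤ} (h : IsEntireLift H F G A) {D : ℝ} (hD : ∀ x, ‖fderiv ℝ F x‖ ≤ D)
    (u v : Torus) : dist (H u) (H v) ≤ D * dist u v := by
  obtain ⟨x, y, rfl, rfl, hxy⟩ := exists_dist_le_of_torus u v
  rw [← h.lift, ← h.lift]
  have hD0 : 0 ≤ D := (norm_nonneg _).trans (hD 0)
  calc dist (proj (F x)) (proj (F y)) ≤ dist (F x) (F y) := dist_proj_le _ _
    _ ≤ D * dist x y := by
        rw [dist_eq_norm, dist_eq_norm]
        exact convex_univ.norm_image_sub_le_of_norm_fderiv_le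
          (fun z _ => h.differentiable_real z) (fun z _ => hD z) trivial trivial
    _ ≤ D * dist (proj x) (proj y) := by gcongr

/-- Mutually inverse entire lifts of `H` and `H⁻¹`. -/
structure EntireLift (H : Torus ≃ Torus) where
  F : ℝ × ℝ → ℝ × ℝ
  F' : ℝ × ℝ → ℝ × ℝ
  G : ℂ × ℂ → ℂ × ℂ
  G' : ℂ × ℂ → ℂ × ℂ
  A : ℤ × ℤ ≃ ℤ × ℤ
  isLift : IsEntireLift H F G A
  isLift' : IsEntireLift H.symm F' G' A.symm
  left_inv : ∀ z, G' (G z) = z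
  right_inv : ∀ z, G (G' z) = z

namespace EntireLift

variable {H H₁ H₂ : Torus ≃ Torus}

theorem real_left_inv (L : EntireLift H) (x : ℝ × ℝ) : L.F' (L.F x) = x := by
  apply emb_injective
  rw [← L.isLift'.extends_real, ← L.isLift.extends_real, L.left_inv]

def refl : EntireLift (Equiv.refl Torus) where
  F := id
  F' := id
  G := id
  G' := id
  A := Equiv.refl _
  isLift := ⟨differentiable_id, fun _ => rfl, fun _ => rfl, fun _ _ => rfl, fun x => by simp [jac]⟩
  isLift' := ⟨differentiable_id, fun _ => rfl, fun _ => rfl, fun _ _ => rfl, fun x => by simp [jac]⟩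
  left_inv _ := rfl
  right_inv _ := rfl

def symm (L : EntireLift H) : EntireLift H.symm where
  F := L.F'
  F' := L.F
  G := L.G'
  G' := L.G
  A := L.A.symm
  isLift := L.isLift'
  isLift' := L.isLift
  left_inv := L.right_inv
  right_inv := L.left_inv

def trans (L₁ : EntireLift H₁) (L₂ : EntireLift H₂) : EntireLift (H₁.trans H₂) where
  F := L₂.F ∘ L₁.F
  F' := L₁.F' ∘ L₂.F'
  G := L₂.G ∘ L₁.G
  G' := L₁.G' ∘ L₂.G'
  A := L₁.A.trans L₂.A
  isLift := L₂.isLift.comp L₁.isLift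
  isLift' := L₁.isLift'.comp L₂.isLift'
  left_inv z := by simp [L₁.left_inv, L₂.left_inv]
  right_inv z := by simp [L₁.right_inv, L₂.right_inv]

theorem isAnalyticDiffeo (L : EntireLift H) : IsAnalyticDiffeo H :=
  ⟨⟨L.F, L.isLift.isAnalyticLift⟩, ⟨L.F', L.isLift'.isAnalyticLift⟩⟩

/-- Bounds on `DH` alone control `H⁻¹` as well, because the Jacobian is `1`. The factor `2` passes
from entries to the operator norm for the maximum norm. -/
theorem dist_le (L : EntireLift H) {D : ℝ} (hD0 : 0 ≤ D) (hD : derivSup H ≤ ENNReal.ofReal D)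
    (u v : Torus) :
    dist (H u) (H v) ≤ 2 * D * dist u v ∧ dist (H.symm u) (H.symm v) ≤ 2 * D * dist u v := by
  have hb : ∀ x, ‖fderiv ℝ L.F x (1, 0)‖ ≤ D ∧ ‖fderiv ℝ L.F x (0, 1)‖ ≤ D := by
    intro x
    have h1 := (L.isLift.enorm_fderiv_le_derivSup x).trans hD
    rw [max_le_iff, ← ofReal_norm, ← ofReal_norm, ENNReal.ofReal_le_ofReal_iff hD0,
      ENNReal.ofReal_le_ofReal_iff hD0] at h1
    exact h1
  refine ⟨L.isLift.dist_le (fun x => norm_apply_le_of_basis (hb x).1 (hb x).2) u v,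
    L.isLift'.dist_le (fun y => ?_) u v⟩
  obtain ⟨x, rfl⟩ : ∃ x, L.F x = y := ⟨L.F' y, L.symm.real_left_inv y⟩
  have hinv : ∀ v, fderiv ℝ L.F' (L.F x) (fderiv ℝ L.F x v) = v := by
    intro v
    rw [← ContinuousLinearMap.comp_apply, ← fderiv_comp x (L.isLift'.differentiable_real _)
      (L.isLift.differentiable_real _)]
    have : L.F' ∘ L.F = id := funext L.real_left_inv
    rw [this, fderiv_id]
    rfl
  have := norm_apply_le_of_comp_eq_id (L.isLift.jac_eq_one x) hinv (hb x).1 (hb x).2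
  exact norm_apply_le_of_basis this.1 this.2

end EntireLift

/-! ### Entire lifts of the shears -/

/-- `ψ` extends to an entire function. -/
def IsEntire (ψ : UnitAddCircle → ℝ) : Prop :=
  ∃ g : ℂ → ℂ, Differentiable ℂ g ∧ ∀ x : ℝ, g (x : ℂ) = (ψ (x : UnitAddCircle) : ℂ)

theorem IsEntire.neg {ψ : UnitAddCircle → ℝ} (h : IsEntire ψ) : IsEntire fun x => -ψ x := by
  obtain ⟨g, hg, hgψ⟩ := h
  exact ⟨fun z => -g z, hg.neg, fun x => by simp [hgψ]⟩

theorem isEntire_const (t : ℝ) : IsEntire fun _ => t :=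
  ⟨fun _ => t, differentiable_const _, fun _ => rfl⟩

/-- Entire functions that agree on the real line are equal. -/
theorem eq_of_eqOn_real {f g : ℂ → ℂ} (hf : Differentiable ℂ f) (hg : Differentiable ℂ g)
    (h : ∀ x : ℝ, f x = g x) : f = g := by
  refine AnalyticOnNhd.eq_of_frequently_eq (z₀ := 0) (fun z _ => hf.analyticAt z)
    (fun z _ => hg.analyticAt z) ?_
  have ht : Tendsto (fun x : ℝ => (x : ℂ)) (𝓝[≠] 0) (𝓝[≠] 0) := by
    refine tendsto_nhdsWithin_iff.2 ⟨?_, ?_⟩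
    · exact tendsto_nhdsWithin_of_tendsto_nhds
        (Complex.continuous_ofReal.tendsto' _ _ Complex.ofReal_zero)
    · filter_upwards [self_mem_nhdsWithin] with x hx
      simpa using hx
  exact ht.frequently (Eventually.of_forall h).frequently

/-- Periodicity passes from the real line to `ℂ` by the identity theorem. -/
theorem periodic_of_extends {ψ : UnitAddCircle → ℝ} {g : ℂ → ℂ} (hg : Differentiable ℂ g)
    (h : ∀ x : ℝ, g x = (ψ (x : UnitAddCircle) : ℂ)) (z : ℂ) (m : ℤ) : g (z + (m : ℝ)) = g z := by
  refine congrFun (eq_of_eqOn_real (f := fun z => g (z + (m : ℝ))) (by fun_prop) hg fun x => ?_) z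
  rw [← Complex.ofReal_add, h, h, circle_coe_eq_coe_iff.2 ⟨m, rfl⟩]

theorem hasDerivAt_of_extends {ψ : UnitAddCircle → ℝ} {g : ℂ → ℂ} (hg : Differentiable ℂ g)
    (h : ∀ x : ℝ, g x = (ψ (x : UnitAddCircle) : ℂ)) (x : ℝ) :
    HasDerivAt (fun x : ℝ => ψ x) (deriv g x).re x := by
  have := (hg x).hasDerivAt.real_of_complex
  simpa [h] using this

theorem IsEntire.continuous {ψ : UnitAddCircle → ℝ} (h : IsEntire ψ) : Continuous ψ := by
  obtain ⟨g, hg, hgψ⟩ := h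
  have : Continuous fun x : ℝ => ψ x :=
    continuous_iff_continuousAt.2 fun x => (hasDerivAt_of_extends hg hgψ x).continuousAt
  exact continuous_coinduced_dom.2 this

theorem isEntireLift_shearFst {ψ : UnitAddCircle → ℝ} {g : ℂ → ℂ} (hg : Differentiable ℂ g)
    (h : ∀ x : ℝ, g x = (ψ (x : UnitAddCircle) : ℂ)) :
    IsEntireLift (shearFst ψ) (fun x => (x.1 + ψ x.2, x.2)) (fun z => (z.1 + g z.2, z.2)) id where
  differentiable := by fun_prop
  extends_real x := by simp [emb, h]
  lift x := by simp [proj, shearFst]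
  equivariant z m := by
    simp only [emb, intVec, Prod.fst_add, Prod.snd_add, periodic_of_extends hg h, id]
    ext <;> simp only [Prod.fst_add, Prod.snd_add]
    ring
  jac_eq_one x := by
    have h1 : HasFDerivAt (fun x : ℝ × ℝ => (x.1 + ψ x.2, x.2))
        ((ContinuousLinearMap.fst ℝ ℝ ℝ + (deriv g x.2).re • ContinuousLinearMap.snd ℝ ℝ ℝ).prod
          (ContinuousLinearMap.snd ℝ ℝ ℝ)) x :=
      (hasFDerivAt_fst.add ((hasDerivAt_of_extends hg h x.2).comp_hasFDerivAt x
        hasFDerivAt_snd)).prodMk hasFDerivAt_snd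
    rw [h1.fderiv]
    simp [jac]

theorem isEntireLift_shearSnd {ψ : UnitAddCircle → ℝ} {g : ℂ → ℂ} (hg : Differentiable ℂ g)
    (h : ∀ x : ℝ, g x = (ψ (x : UnitAddCircle) : ℂ)) :
    IsEntireLift (shearSnd ψ) (fun x => (x.1, x.2 + ψ x.1)) (fun z => (z.1, z.2 + g z.1)) id where
  differentiable := by fun_prop
  extends_real x := by simp [emb, h]
  lift x := by simp [proj, shearSnd]
  equivariant z m := by
    simp only [emb, intVec, Prod.fst_add, Prod.snd_add, periodic_of_extends hg h, id]
    ext <;> simp only [Prod.fst_add, Prod.snd_add]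
    ring
  jac_eq_one x := by
    have h1 : HasFDerivAt (fun x : ℝ × ℝ => (x.1, x.2 + ψ x.1))
        ((ContinuousLinearMap.fst ℝ ℝ ℝ).prod
          (ContinuousLinearMap.snd ℝ ℝ ℝ + (deriv g x.1).re • ContinuousLinearMap.fst ℝ ℝ ℝ)) x :=
      hasFDerivAt_fst.prodMk (hasFDerivAt_snd.add
        ((hasDerivAt_of_extends hg h x.1).comp_hasFDerivAt x hasFDerivAt_fst))
    rw [h1.fderiv]
    simp [jac]

theorem shearFst_symm (ψ : UnitAddCircle → ℝ) : (shearFst ψ).symm = shearFst fun x => -ψ x := by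
  ext x <;> simp [shearFst, sub_eq_add_neg]

theorem shearSnd_symm (ψ : UnitAddCircle → ℝ) : (shearSnd ψ).symm = shearSnd fun x => -ψ x := by
  ext x <;> simp [shearSnd, sub_eq_add_neg]

theorem nonempty_entireLift_shearFst {ψ : UnitAddCircle → ℝ} (h : IsEntire ψ) :
    Nonempty (EntireLift (shearFst ψ)) := by
  obtain ⟨g, hg, hgψ⟩ := h
  have h' : IsEntireLift (shearFst ψ).symm (fun x => (x.1 + -ψ x.2, x.2))
      (fun z => (z.1 + -g z.2, z.2)) id := by
    rw [shearFst_symm]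
    exact isEntireLift_shearFst (ψ := fun x => -ψ x) hg.neg fun x => by simp [hgψ]
  exact ⟨⟨_, _, _, _, Equiv.refl _, isEntireLift_shearFst hg hgψ, h', by simp, by simp⟩⟩

theorem nonempty_entireLift_shearSnd {ψ : UnitAddCircle → ℝ} (h : IsEntire ψ) :
    Nonempty (EntireLift (shearSnd ψ)) := by
  obtain ⟨g, hg, hgψ⟩ := h
  have h' : IsEntireLift (shearSnd ψ).symm (fun x => (x.1, x.2 + -ψ x.1))
      (fun z => (z.1, z.2 + -g z.1)) id := by
    rw [shearSnd_symm]
    exact isEntireLift_shearSnd (ψ := fun x => -ψ x) hg.neg fun x => by simp [hgψ]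
  exact ⟨⟨_, _, _, _, Equiv.refl _, isEntireLift_shearSnd hg hgψ, h', by simp, by simp⟩⟩

theorem isEntireLift_twist (a : ℤ) :
    IsEntireLift (fun x => (x.1, x.2 + a • x.1)) (fun x => (x.1, x.2 + a * x.1))
      (fun z => (z.1, z.2 + a * z.1)) (fun m => (m.1, m.2 + a * m.1)) where
  differentiable := by fun_prop
  extends_real x := by simp [emb]
  lift x := by
    simp only [proj, AddCircle.coe_add, Prod.mk.injEq, true_and]
    rw [← zsmul_eq_mul, AddCircle.coe_zsmul]
  equivariant z m := by
    simp only [emb, intVec, Prod.fst_add, Prod.snd_add]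
    ext <;> simp only [Prod.fst_add, Prod.snd_add]
    push_cast
    ring
  jac_eq_one x := by
    have h1 : HasFDerivAt (fun x : ℝ × ℝ => (x.1, x.2 + (a : ℝ) * x.1))
        ((ContinuousLinearMap.fst ℝ ℝ ℝ).prod
          (ContinuousLinearMap.snd ℝ ℝ ℝ + (a : ℝ) • ContinuousLinearMap.fst ℝ ℝ ℝ)) x :=
      hasFDerivAt_fst.prodMk (hasFDerivAt_snd.add (hasFDerivAt_fst.const_mul _))
    rw [h1.fderiv]
    simp [jac]

theorem nonempty_entireLift_twist (q : ℕ) : Nonempty (EntireLift (twist q)) := by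
  let A : ℤ × ℤ ≃ ℤ × ℤ := ⟨fun m => (m.1, m.2 + (q : ℤ) * m.1),
    fun m => (m.1, m.2 + (-(q : ℤ)) * m.1), fun m => by simp, fun m => by simp⟩
  have h : IsEntireLift (twist q) (fun x => (x.1, x.2 + (q : ℤ) * x.1))
      (fun z => (z.1, z.2 + (q : ℤ) * z.1)) A := by
    have e : (twist q : Torus → Torus) = fun x => (x.1, x.2 + (q : ℤ) • x.1) := by
      ext x <;> simp [twist]
    rw [e]
    exact isEntireLift_twist q
  have h' : IsEntireLift (twist q).symm (fun x => (x.1, x.2 + (-(q : ℤ) : ℤ) * x.1))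
      (fun z => (z.1, z.2 + (-(q : ℤ) : ℤ) * z.1)) A.symm := by
    have e : ((twist q).symm : Torus → Torus) = fun x => (x.1, x.2 + (-(q : ℤ)) • x.1) := by
      ext x <;> simp [twist, sub_eq_add_neg]
    rw [e]
    exact isEntireLift_twist (-(q : ℤ))
  exact ⟨⟨_, _, _, _, A, h, h', by simp, by simp⟩⟩

/-! ### Conjugates of the circle action -/

/-- The conjugate `H⁻¹ ∘ φ^t ∘ H` of the circle action. -/
def conjFlow (H : Torus ≃ Torus) (t : ℝ) : Torus ≃ Torus := (H.trans (flow t)).trans H.symm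

theorem conjFlow_apply (H : Torus ≃ Torus) (t : ℝ) (u : Torus) :
    conjFlow H t u = H.symm (flow t (H u)) := rfl

theorem flow_symm (t : ℝ) : (flow t).symm = flow (-t) := shearFst_symm _

theorem conjFlow_symm (H : Torus ≃ Torus) (t : ℝ) : (conjFlow H t).symm = conjFlow H (-t) := by
  rw [conjFlow, conjFlow, ← flow_symm]
  rfl

/-- Points of a strip can be moved to a compact set by integer translations. -/
theorem exists_add_intVec_mem {ρ : ℝ} {z : ℂ × ℂ} (hz : z ∈ strip ρ) :
    ∃ m, z + emb (intVec m) ∈ (Set.Icc (0 : ℝ) 1 ×ℂ Set.Icc (-ρ) ρ) ×ˢ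
      (Set.Icc (0 : ℝ) 1 ×ℂ Set.Icc (-ρ) ρ) := by
  obtain ⟨h1, h2⟩ := hz
  rw [abs_lt] at h1 h2
  have hf : ∀ x : ℝ, 0 ≤ x + -⌊x⌋ ∧ x + -⌊x⌋ ≤ 1 := fun x =>
    ⟨by linarith [Int.floor_le x], by linarith [Int.lt_floor_add_one x]⟩
  refine ⟨(-⌊z.1.re⌋, -⌊z.2.re⌋), ?_⟩
  simp only [Set.mem_prod, Complex.mem_reProdIm, Set.mem_Icc, emb, intVec, Prod.fst_add,
    Prod.snd_add, Complex.add_re, Complex.add_im, Complex.ofReal_re, Complex.ofReal_im, add_zero]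
  push_cast
  exact ⟨⟨hf _, h1.1.le, h1.2.le⟩, ⟨hf _, h2.1.le, h2.2.le⟩⟩

theorem isCompact_stripCell (ρ : ℝ) : IsCompact ((Set.Icc (0 : ℝ) 1 ×ℂ Set.Icc (-ρ) ρ) ×ˢ
      (Set.Icc (0 : ℝ) 1 ×ℂ Set.Icc (-ρ) ρ)) :=
  (isCompact_Icc.reProdIm isCompact_Icc).prod (isCompact_Icc.reProdIm isCompact_Icc)

namespace EntireLift

variable {H : Torus ≃ Torus}

/-- The holomorphic displacement of `H⁻¹ ∘ φ^t ∘ H`. -/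
def disp (L : EntireLift H) (t : ℝ) (z : ℂ × ℂ) : ℂ × ℂ := L.G' (L.G z + emb (t, 0)) - z

/-- The real displacement of `H⁻¹ ∘ φ^t ∘ H`. -/
def realDisp (L : EntireLift H) (t : ℝ) (x : ℝ × ℝ) : ℝ × ℝ := L.F' (L.F x + (t, 0)) - x

theorem disp_emb (L : EntireLift H) (t : ℝ) (x : ℝ × ℝ) :
    L.disp t (emb x) = emb (L.realDisp t x) := by
  rw [disp, L.isLift.extends_real, ← emb_add, L.isLift'.extends_real, realDisp, sub_eq_iff_eq_add,
    ← emb_add, sub_add_cancel]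

theorem differentiable_disp (L : EntireLift H) (t : ℝ) : Differentiable ℂ (L.disp t) :=
  (L.isLift'.differentiable.comp (L.isLift.differentiable.add_const _)).sub differentiable_id

theorem continuous_disp (L : EntireLift H) : Continuous fun p : ℝ × ℂ × ℂ => L.disp p.1 p.2 := by
  have h1 := L.isLift.differentiable.continuous
  have h2 := L.isLift'.differentiable.continuous
  unfold disp emb
  fun_prop

/-- The twist makes `H` act nontrivially on `ℤ²`, but this action is undone by `H⁻¹`: conjugates of
translations are homotopic to the identity even when `H` is not. -/
theorem disp_add_intVec (L : EntireLift H) (t : ℝ) (z : ℂ × ℂ) (m : ℤ × ℤ) :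
    L.disp t (z + emb (intVec m)) = L.disp t z := by
  rw [disp, L.isLift.equivariant, add_right_comm, L.isLift'.equivariant, Equiv.symm_apply_apply,
    disp]
  abel

theorem realDisp_add_intVec (L : EntireLift H) (t : ℝ) (x : ℝ × ℝ) (m : ℤ × ℤ) :
    L.realDisp t (x + intVec m) = L.realDisp t x := by
  apply emb_injective
  rw [← disp_emb, emb_add, disp_add_intVec, disp_emb]

/-- The real displacement as a pair of functions. -/
def dispFun (L : EntireLift H) (t : ℝ) (i : Fin 2) (x : ℝ × ℝ) : ℝ :=
  if i = 0 then (L.realDisp t x).1 else (L.realDisp t x).2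

theorem isDisplacement (L : EntireLift H) (t : ℝ) : IsDisplacement (conjFlow H t) (L.dispFun t) where
  continuous i := by
    have h : Continuous (L.realDisp t) :=
      (L.isLift'.continuous.comp (L.isLift.continuous.add_const _)).sub continuous_id
    unfold dispFun
    split_ifs
    · exact h.fst
    · exact h.snd
  periodic i := isPeriodic_iff.2 fun x m => by simp only [dispFun, realDisp_add_intVec]
  lift x := by
    have h1 : (x.1 + L.dispFun t 0 x, x.2 + L.dispFun t 1 x) = L.F' (L.F x + (t, 0)) := by
      ext <;> simp [dispFun, realDisp]
    have h2 : ∀ y, proj (y + (t, 0)) = flow t (proj y) := fun y => by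
      simp [proj, flow, shearFst]
    rw [h1, L.isLift'.lift, h2, L.isLift.lift, conjFlow_apply]

theorem hasExtension_dispFun_sub (L : EntireLift H) {ρ s t M : ℝ}
    (h : ∀ z ∈ strip ρ, ‖L.disp s z - L.disp t z‖ ≤ M) (i : Fin 2) :
    HasExtension ρ (fun x => L.dispFun s i x - L.dispFun t i x) M := by
  have hd := ((L.differentiable_disp s).sub (L.differentiable_disp t)).differentiableOn (s := strip ρ)
  have he : ∀ x : ℝ × ℝ, L.disp s ((x.1 : ℂ), (x.2 : ℂ)) - L.disp t ((x.1 : ℂ), (x.2 : ℂ)) =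
      emb (L.realDisp s x) - emb (L.realDisp t x) := fun x => by rw [← disp_emb, ← disp_emb]; rfl
  by_cases hi : i = 0
  · refine ⟨fun z => (L.disp s z - L.disp t z).1, hd.fst, fun x => ?_, fun z hz =>
      (norm_fst_le _).trans (h z hz)⟩
    simp only [he, dispFun, hi, if_true]
    simp [emb]
  · refine ⟨fun z => (L.disp s z - L.disp t z).2, hd.snd, fun x => ?_, fun z hz =>
      (norm_snd_le _).trans (h z hz)⟩
    simp only [he, dispFun, hi, if_false]
    simp [emb]

theorem disp_zero (L : EntireLift H) (z : ℂ × ℂ) : L.disp 0 z = 0 := by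
  have : emb (0, 0) = 0 := by simp [emb]
  rw [disp, this, add_zero, L.left_inv, sub_self]

theorem hasTameDisplacement (L : EntireLift H) (t : ℝ) : HasTameDisplacement (conjFlow H t) := by
  refine ⟨_, L.isDisplacement t, fun i ρ => ?_⟩
  obtain ⟨M, hM⟩ := (isCompact_stripCell ρ).exists_bound_of_continuousOn
    (L.differentiable_disp t).continuous.continuousOn
  -- At time `0` the displacement vanishes, so the lemma on differences of displacements covers a
  -- single one.
  have h0 : ∀ x, L.dispFun 0 i x = 0 := by
    intro x
    have : L.realDisp 0 x = 0 := emb_injective (by rw [← disp_emb, disp_zero]; simp [emb]; rfl)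
    simp [dispFun, this]
  refine ⟨M, ?_⟩
  have := L.hasExtension_dispFun_sub (ρ := ρ) (s := t) (t := 0) (M := M) (fun z hz => ?_) i
  · simpa [h0] using this
  · rw [disp_zero, sub_zero]
    obtain ⟨m, hm⟩ := exists_add_intVec_mem hz
    rw [← L.disp_add_intVec t z m]
    exact hM _ hm

/-- `H⁻¹ ∘ φ^t ∘ H` depends continuously on `t` in the analytic topology. -/
theorem tendsto_analyticDist (L : EntireLift H) (t ρ : ℝ) :
    Tendsto (fun s => analyticDist ρ (conjFlow H t) (conjFlow H s)) (𝓝 t) (𝓝 0) := by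
  have key : ∀ ε > 0, ∀ᶠ s in 𝓝 t, ∀ z ∈ (Set.Icc (0 : ℝ) 1 ×ℂ Set.Icc (-ρ) ρ) ×ˢ
      (Set.Icc (0 : ℝ) 1 ×ℂ Set.Icc (-ρ) ρ), ‖L.disp t z - L.disp s z‖ < ε := by
    intro ε hε
    refine (isCompact_stripCell ρ).eventually_forall_of_forall_eventually fun z _ => ?_
    have hc : Continuous fun p : ℝ × ℂ × ℂ => ‖L.disp t p.2 - L.disp p.1 p.2‖ :=
      ((L.continuous_disp.comp (continuous_const.prodMk continuous_snd)).sub L.continuous_disp).norm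
    have := hc.tendsto (t, z)
    simp only [sub_self, norm_zero] at this
    exact this.eventually (gt_mem_nhds hε)
  refine ENNReal.tendsto_nhds_zero.2 fun ε hε => ?_
  rcases eq_or_ne ε ⊤ with rfl | hε'
  · exact Eventually.of_forall fun _ => le_top
  filter_upwards [key ε.toReal (ENNReal.toReal_pos hε.ne' hε')] with s hs
  rw [← ENNReal.ofReal_toReal hε']
  refine analyticDist_le (L.isDisplacement t) (L.isDisplacement s)
    (L.hasExtension_dispFun_sub fun z hz => ?_)
  obtain ⟨m, hm⟩ := exists_add_intVec_mem hz
  rw [← L.disp_add_intVec t z m, ← L.disp_add_intVec s z m]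
  exact (hs _ hm).le

end EntireLift

theorem HasTameDisplacement.exists_memAnalytic {T : Torus → Torus} (h : HasTameDisplacement T)
    {ρ : ℝ} (hρ : 0 < ρ) : ∃ f, IsDisplacement T f ∧ ∀ i, MemAnalytic ρ (f i) := by
  obtain ⟨f, hf, hM⟩ := h
  exact ⟨f, hf, fun i => hf.memAnalytic hρ (hM i ρ).choose_spec⟩

theorem nonempty_entireLift_conjFlow {H : Torus ≃ Torus} (L : EntireLift H) (t : ℝ) :
    Nonempty (EntireLift (conjFlow H t)) := by
  obtain ⟨M⟩ := nonempty_entireLift_shearFst (isEntire_const t)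
  exact ⟨(L.trans M).trans L.symm⟩

/-! ### Existence of approximate step functions -/

theorem exists_extension_of_mem_span_fourier {P : C(UnitAddCircle, ℂ)}
    (hP : P ∈ Submodule.span ℂ (Set.range (@fourier 1))) :
    ∃ g : ℂ → ℂ, Differentiable ℂ g ∧ ∀ x : ℝ, g x = P x := by
  induction hP using Submodule.span_induction with
  | mem P hP =>
    obtain ⟨n, rfl⟩ := hP
    refine ⟨fun z => Complex.exp (2 * Real.pi * Complex.I * n * z / (1 : ℝ)), by fun_prop,
      fun x => fourier_coe_apply.symm⟩
  | zero => exact ⟨0, differentiable_const 0, fun _ => rfl⟩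
  | add P Q _ _ hP hQ =>
    obtain ⟨g, hg, hgP⟩ := hP
    obtain ⟨g', hg', hgQ⟩ := hQ
    exact ⟨fun z => g z + g' z, hg.add hg', fun x => by simp [hgP, hgQ]⟩
  | smul c P _ hP =>
    obtain ⟨g, hg, hgP⟩ := hP
    exact ⟨fun z => c * g z, hg.const_mul c, fun x => by simp [hgP]⟩

/-- Entire functions are dense in the continuous real functions on the circle. -/
theorem exists_isEntire_near {f : UnitAddCircle → ℝ} (hf : Continuous f) {ε : ℝ} (hε : 0 < ε) :
    ∃ s, IsEntire s ∧ ∀ x, |s x - f x| < ε := by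
  let fc : C(UnitAddCircle, ℂ) := ⟨fun x => (f x : ℂ), by fun_prop⟩
  have h : fc ∈ (Submodule.span ℂ (Set.range (@fourier 1))).topologicalClosure := by
    rw [span_fourier_closure_eq_top]
    trivial
  obtain ⟨P, hP, hPf⟩ := Metric.mem_closure_iff.1 h ε hε
  obtain ⟨g, hg, hgP⟩ := exists_extension_of_mem_span_fourier hP
  -- The real part is not holomorphic; on the real line it agrees with the average of `g` and its
  -- reflection `conj ∘ g ∘ conj`, which is entire.
  refine ⟨fun x => (P x).re, ⟨fun z => (g z + starRingEnd ℂ (g (starRingEnd ℂ z))) / 2, ?_,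
    fun x => ?_⟩, fun x => ?_⟩
  · refine (hg.add fun z => ?_).div_const 2
    have := DifferentiableAt.conj_conj (hg (starRingEnd ℂ z))
    rwa [Complex.conj_conj] at this
  · beta_reduce
    rw [Complex.conj_ofReal, hgP, Complex.add_conj]
    push_cast
    ring
  · have h1 : ‖(P x) - fc x‖ < ε := by
      rw [← dist_eq_norm, dist_comm]
      exact (ContinuousMap.dist_apply_le_dist x).trans_lt hPf
    exact (Complex.abs_re_le_norm (P x - fc x)).trans_lt h1

/-- The trapezoid of height `1` and slope `C` over the interval `[u, v]`. -/
def trapezoid (C u v x : ℝ) : ℝ := max 0 (min 1 (C * min (x - u) (v - x)))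

theorem continuous_trapezoid (C u v : ℝ) : Continuous (trapezoid C u v) := by
  unfold trapezoid
  fun_prop

theorem trapezoid_eq_zero {C u v x : ℝ} (hC : 0 ≤ C) (h : x ≤ u ∨ v ≤ x) :
    trapezoid C u v x = 0 := by
  refine max_eq_left (min_le_iff.2 (Or.inr (mul_nonpos_of_nonneg_of_nonpos hC (min_le_iff.2 ?_))))
  rcases h with h | h
  · exact Or.inl (by linarith)
  · exact Or.inr (by linarith)

theorem trapezoid_eq_one {C u v x : ℝ} (h1 : 1 ≤ C * (x - u)) (h2 : 1 ≤ C * (v - x)) :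
    trapezoid C u v x = 1 := by
  have : 1 ≤ C * min (x - u) (v - x) := by
    rcases min_choice (x - u) (v - x) with h | h <;> rw [h] <;> assumption
  rw [trapezoid, min_eq_left this]
  simp

/-- A sum of trapezoids, one per cell, vanishes at the cell ends and hence is continuous on the
circle. The slope `2k/δ` lets it reach the step value at distance `δ/(2k)` from the ends. A real
trigonometric polynomial within `ε/2` of it, composed with multiplication by `N`, is the
approximation. -/
theorem exists_isStepApprox {k N : ℕ} (hk : 0 < k) (hN : 0 < N) (a : ℕ → ℝ) {ε δ : ℝ} (hε : 0 < ε)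
    (hδ : 0 < δ) : ∃ s, IsStepApprox k N a ε δ s := by
  have hk' : (0 : ℝ) < k := by exact_mod_cast hk
  have hN' : (0 : ℝ) < N := by exact_mod_cast hN
  set C : ℝ := 2 * k / δ with hC
  have hC0 : 0 < C := by positivity
  let f : ℝ → ℝ := fun x => ∑ i ∈ Finset.range k, a i * trapezoid C (i / k) ((i + 1) / k) x
  have hfc : Continuous f := continuous_finsetSum _ fun i _ =>
    continuous_const.mul (continuous_trapezoid _ _ _)
  have hf0 : f 0 = 0 := Finset.sum_eq_zero fun i _ => by
    rw [trapezoid_eq_zero hC0.le (Or.inl (by positivity)), mul_zero]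
  have hf1 : f 1 = 0 := Finset.sum_eq_zero fun i hi => by
    rw [trapezoid_eq_zero hC0.le (Or.inr ?_), mul_zero]
    rw [div_le_one hk']
    exact_mod_cast Finset.mem_range.1 hi
  obtain ⟨s, ⟨g, hg, hgs⟩, hs⟩ := exists_isEntire_near
    (AddCircle.liftIco_zero_continuous (p := (1 : ℝ)) (hf0.trans hf1.symm) hfc.continuousOn)
    (half_pos hε)
  refine ⟨fun y => s (N • y), ⟨fun z => g (N * z), by fun_prop, fun x => ?_⟩, fun x => ?_,
    ε / 2, half_lt_self hε, fun x hx hfar => ?_⟩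
  · have := hgs (N * x)
    push_cast at this
    beta_reduce
    rw [this, ← AddCircle.coe_nsmul, nsmul_eq_mul]
  · simp only [← AddCircle.coe_nsmul, nsmul_eq_mul]
    congr 1
    rw [mul_add, mul_one_div_cancel hN'.ne']
    exact circle_coe_eq_coe_iff.2 ⟨1, by simp⟩
  · set I : ℕ := ⌊(k : ℝ) * N * x⌋₊ with hI
    have hx0 : 0 ≤ (k : ℝ) * N * x := mul_nonneg (by positivity) hx.1
    have hI1 : (I : ℝ) ≤ k * N * x := Nat.floor_le hx0
    have hI2 : (k : ℝ) * N * x < I + 1 := Nat.lt_floor_add_one _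
    have hIlt : I < k * N := by
      have : (I : ℝ) < k * N := by
        have h2 : (k : ℝ) * N * x < k * N * 1 := by gcongr; exact hx.2
        linarith
      exact_mod_cast this
    set j := I % k with hj
    set M := I / k with hM
    have hIj : (I : ℝ) = k * M + j := by exact_mod_cast (Nat.div_add_mod I k).symm
    have hjk : j < k := Nat.mod_lt _ hk
    have hjk' : (j : ℝ) + 1 ≤ k := by exact_mod_cast hjk
    -- `w` is the position within the period of length `1/N` containing `x`, rescaled to `[0, 1)`;
    -- cell `I` becomes cell `j = I mod k` of the case `N = 1`.
    set w : ℝ := N * x - M with hw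
    have hkw : (k : ℝ) * w = k * N * x - k * M := by rw [hw]; ring
    have hw0 : (j : ℝ) ≤ k * w := by linarith
    have hw1 : (k : ℝ) * w < j + 1 := by linarith
    have hwm : w ∈ Set.Ico (0 : ℝ) 1 := by
      refine ⟨?_, ?_⟩
      · by_contra! h
        have := mul_neg_of_pos_of_neg hk' h
        linarith [j.cast_nonneg (α := ℝ)]
      · by_contra! h
        have : (k : ℝ) * 1 ≤ k * w := by gcongr
        linarith
    have hval : s (N • (x : UnitAddCircle)) = s w := by
      congr 1
      rw [← AddCircle.coe_nsmul, nsmul_eq_mul]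
      exact circle_coe_eq_coe_iff.2 ⟨M, by rw [hw]; push_cast; ring⟩
    have hfw : f w = a j := by
      have h1 : trapezoid C (j / k) ((j + 1) / k) w = 1 := by
        have e1 := hfar I hIlt.le
        have e2 := hfar (I + 1) hIlt
        have c1 : 0 ≤ x - I / (k * N) := by
          rw [sub_nonneg, div_le_iff₀ (by positivity)]; linarith
        have c2 : 0 ≤ ((I + 1 : ℕ) : ℝ) / (k * N) - x := by
          rw [sub_nonneg, le_div_iff₀ (by positivity)]; push_cast; linarith
        rw [abs_of_nonneg c1] at e1
        rw [abs_sub_comm, abs_of_nonneg c2] at e2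
        have f1 : C * (w - j / k) = 2 * k * N / δ * (x - I / (k * N)) := by
          rw [hC, hw, hIj]; field_simp; ring
        have f2 : C * ((j + 1) / k - w) = 2 * k * N / δ * (((I + 1 : ℕ) : ℝ) / (k * N) - x) := by
          rw [hC, hw]; push_cast; rw [hIj]; field_simp; ring
        have f3 : 2 * k * N / δ * (δ / (2 * k * N)) = 1 := by field_simp
        refine trapezoid_eq_one ?_ ?_
        · rw [f1, ← f3]; gcongr
        · rw [f2, ← f3]; gcongr
      have h2 : ∀ i ∈ Finset.range k, i ≠ j → a i * trapezoid C (i / k) ((i + 1) / k) w = 0 := by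
        intro i _ hij
        rw [trapezoid_eq_zero hC0.le, mul_zero]
        rcases lt_or_gt_of_ne hij with h | h
        · right
          rw [div_le_iff₀ hk', mul_comm w]
          have : (i : ℝ) + 1 ≤ j := by exact_mod_cast h
          linarith
        · left
          rw [le_div_iff₀ hk', mul_comm w]
          have : (j : ℝ) + 1 ≤ i := by exact_mod_cast h
          linarith
      simp only [f]
      rw [Finset.sum_eq_single_of_mem j (Finset.mem_range.2 hjk) h2, h1, mul_one]
    have := hs w
    rw [AddCircle.liftIco_zero_coe_apply hwm, hfw] at this
    rw [hval, stepFun]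
    exact this.le

/-! ### Measure preservation -/

theorem measurePreserving_shearSnd {ψ : UnitAddCircle → ℝ} (h : Measurable ψ) :
    MeasurePreserving (shearSnd ψ) volume volume := by
  rw [Measure.volume_eq_prod]
  have hm : Measurable fun x => (ψ x : UnitAddCircle) :=
    (AddCircle.continuous_mk' 1).measurable.comp h
  refine (MeasurePreserving.id volume).skew_product
    (g := fun x y => y + (ψ x : UnitAddCircle)) ?_ (Eventually.of_forall fun x => ?_)
  · exact measurable_snd.add (hm.comp measurable_fst)
  · exact (measurePreserving_add_right volume _).map_eq

theorem measurePreserving_shearFst {ψ : UnitAddCircle → ℝ} (h : Measurable ψ) :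
    MeasurePreserving (shearFst ψ) volume volume := by
  have hs : MeasurePreserving (Prod.swap : Torus → Torus) volume volume :=
    Measure.measurePreserving_swap
  exact (hs.comp (measurePreserving_shearSnd h)).comp hs

theorem measurePreserving_twist (q : ℕ) : MeasurePreserving (twist q) volume volume := by
  rw [Measure.volume_eq_prod]
  refine (MeasurePreserving.id volume).skew_product
    (g := fun x y => y + q • x) ?_ (Eventually.of_forall fun x => ?_)
  · exact (continuous_snd.add (continuous_fst.nsmul q)).measurable
  · exact (measurePreserving_add_right volume _).map_eq

/-! ### The geometry of one step of the construction -/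

theorem exists_rep_Ico (u : UnitAddCircle) : ∃ x : ℝ, x ∈ Set.Ico (0 : ℝ) 1 ∧ (x : UnitAddCircle) = u := by
  obtain ⟨y, rfl⟩ := QuotientAddGroup.mk_surjective u
  exact ⟨Int.fract y, ⟨Int.fract_nonneg y, Int.fract_lt_one y⟩,
    circle_coe_eq_coe_iff.2 ⟨-⌊y⌋, by simp [Int.fract, sub_eq_add_neg]⟩⟩

theorem norm_circle_coe_le (a : ℝ) : ‖(a : UnitAddCircle)‖ ≤ |a| := QuotientAddGroup.norm_mk_le_norm

/-- The points where the steps of the construction are controlled. -/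
def goodSet (c : Choice) (q : ℕ) : Set Torus :=
  {u | (∀ j : ℕ, j ≤ c.l → errDelta c.l q < dist u.2 ((j / c.l : ℝ) : UnitAddCircle)) ∧
    ∀ i : ℕ, i ≤ c.l * (c.l * q) → errDelta c.l q / (2 * c.l * (c.l * q : ℕ)) <
      dist (u.1 + (c.ψ₁ u.2 : UnitAddCircle)) ((i / (c.l * (c.l * q : ℕ)) : ℝ) : UnitAddCircle)}

theorem errDelta_pos {l q : ℕ} (hl : 0 < l) (hq : 0 < q) : 0 < errDelta l q := by
  have : (0 : ℝ) < l := by exact_mod_cast hl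
  have : (0 : ℝ) < q := by exact_mod_cast hq
  unfold errDelta
  positivity

theorem errDelta_le {l q : ℕ} (hl : 0 < l) (hq : 0 < q) : errDelta l q ≤ 1 / ((l : ℝ) ^ 2 * q) := by
  have : (0 : ℝ) < l := by exact_mod_cast hl
  have : (0 : ℝ) < q := by exact_mod_cast hq
  unfold errDelta
  refine one_div_le_one_div_of_le (by positivity) (le_mul_of_one_le_left (by positivity) ?_)
  exact one_le_pow₀ (by norm_num)

theorem stepFun_eq {k N : ℕ} {a : ℕ → ℝ} {x : ℝ} {I : ℕ} (h1 : (I : ℝ) ≤ k * N * x)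
    (h2 : (k : ℝ) * N * x < I + 1) : stepFun k N a x = a (I % k) := by
  rw [stepFun, (Nat.floor_eq_iff ((Nat.cast_nonneg I).trans h1)).2 ⟨h1, h2⟩]

theorem IsStepApprox.near' {k N : ℕ} {a : ℕ → ℝ} {ε δ : ℝ} {s : UnitAddCircle → ℝ}
    (h : IsStepApprox k N a ε δ s) {x : ℝ} (hx : x ∈ Set.Ico (0 : ℝ) 1)
    (hfar : ∀ i : ℕ, i ≤ k * N → δ / (2 * k * N) < |x - (i : ℝ) / (k * N)|) {I : ℕ}
    (h1 : (I : ℝ) ≤ k * N * x) (h2 : (k : ℝ) * N * x < I + 1) : |s x - a (I % k)| ≤ ε := by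
  obtain ⟨ε', hε', hs⟩ := h.near
  rw [← stepFun_eq (a := a) h1 h2]
  exact (hs x hx hfar).trans hε'.le

theorem lt_abs_sub_of_lt_dist {d x y : ℝ} (h : d < dist (x : UnitAddCircle) y) : d < |x - y| :=
  h.trans_le (dist_circle_coe_le x y)

/-- The heart of the construction: the new first coordinate stays near the old one and, multiplied
by `-l q`, recovers the old second coordinate. -/
theorem Choice.Admissible.near_of_mem_goodSet {c : Choice} {n : ℕ} {s : Stage}
    (hc : c.Admissible n s) (hl : 0 < c.l) (hq : 0 < s.q) {u : Torus} (hu : u ∈ goodSet c s.q) :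
    dist (c.h s.q u).1 u.1 ≤ 2 / (c.l * s.q) ∧
      ‖u.2 + (c.l * s.q) • (c.h s.q u).1‖ ≤ 3 / c.l := by
  obtain ⟨hu2, hu1⟩ := hu
  set l := c.l with hldef
  set q := s.q with hqdef
  have hl' : (0 : ℝ) < l := by exact_mod_cast hl
  have hl1 : (1 : ℝ) ≤ l := by exact_mod_cast hl
  have hq' : (0 : ℝ) < q := by exact_mod_cast hq
  have hδ := errDelta_pos hl hq
  have hδle := errDelta_le hl hq
  set δ := errDelta l q with hδdef
  obtain ⟨x, hx, hxu⟩ := exists_rep_Ico u.2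
  set a : UnitAddCircle := u.1 + (c.ψ₁ u.2 : UnitAddCircle) with ha
  obtain ⟨v, hv, hva⟩ := exists_rep_Ico a
  have hxfar : ∀ j : ℕ, j ≤ l → δ < |x - j / l| := fun j hj =>
    lt_abs_sub_of_lt_dist (by rw [hxu]; exact hu2 j hj)
  have hvfar : ∀ i : ℕ, i ≤ l * (l * q) → δ / (2 * l * (l * q : ℕ)) < |v - i / (l * (l * q : ℕ))| :=
    fun i hi => lt_abs_sub_of_lt_dist (by rw [hva]; exact hu1 i hi)
  -- the cell of the second coordinate
  set j : ℕ := ⌊(l : ℝ) * x⌋₊ with hj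
  have hj1 : (j : ℝ) ≤ l * x := Nat.floor_le (mul_nonneg hl'.le hx.1)
  have hj2 : (l : ℝ) * x < j + 1 := Nat.lt_floor_add_one _
  have hjl : j < l := by
    have : (l : ℝ) * x < l * 1 := by gcongr; exact hx.2
    exact_mod_cast (show (j : ℝ) < l by linarith)
  have hxj : δ < x - j / l := by
    have := hxfar j hjl.le
    rwa [abs_of_nonneg] at this
    rw [sub_nonneg, div_le_iff₀ hl']; linarith
  have hxj' : δ < (j + 1) / l - x := by
    have := hxfar (j + 1) hjl
    rw [abs_sub_comm, abs_of_nonneg] at this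
    · exact_mod_cast this
    · rw [sub_nonneg, le_div_iff₀ hl']; push_cast; linarith
  have hsmall : δ / (2 * l * (1 : ℕ)) ≤ δ / 2 := by
    push_cast
    gcongr
    linarith
  have hψ₁ : |c.ψ₁ u.2 - (if j = 0 then 0 else ((l : ℝ) - j) / ((l : ℝ) ^ 2 * q))| ≤ δ / 3 := by
    have := hc.approx₁.near' hx (I := j) (fun i hi => ?_) (by push_cast; linarith)
      (by push_cast; linarith)
    · rw [hxu, Nat.mod_eq_of_lt hjl] at this
      exact this
    · have := hxfar i (by simpa using hi)
      have h4 : δ / (2 * l * (1 : ℕ)) < δ := hsmall.trans_lt (by linarith)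
      simp only [Nat.cast_one, mul_one] at h4 ⊢
      exact h4.trans this
  -- the cell of the first coordinate after the first shear
  set i : ℕ := ⌊(l : ℝ) * (l * q : ℕ) * v⌋₊ with hi
  have hi1 : (i : ℝ) ≤ l * (l * q : ℕ) * v := Nat.floor_le (mul_nonneg (by positivity) hv.1)
  have hi2 : (l : ℝ) * (l * q : ℕ) * v < i + 1 := Nat.lt_floor_add_one _
  set r := i % l with hr
  have hrl : r < l := Nat.mod_lt _ hl
  have hψ₂ : |c.ψ₂ a - r / l| ≤ δ / 3 := by
    have := hc.approx₂.near' hv (I := i) hvfar hi1 hi2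
    rwa [hva] at this
  set e₂ := c.ψ₂ a - r / l with he₂
  set b : UnitAddCircle := u.2 + (c.ψ₂ a : UnitAddCircle) with hb
  -- the cell of the second coordinate after the second shear
  obtain ⟨s', ε', hsl, hε', hjr⟩ : ∃ s' ε' : ℕ, s' < l ∧ (ε' = 0 ∨ ε' = 1) ∧ j + r = s' + ε' * l := by
    rcases lt_or_ge (j + r) l with h | h
    · exact ⟨j + r, 0, h, Or.inl rfl, by simp⟩
    · exact ⟨j + r - l, 1, by omega, Or.inr rfl, by omega⟩
  have hjr' : (j : ℝ) + r = s' + ε' * l := by exact_mod_cast hjr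
  set w : ℝ := x + c.ψ₂ a - ε' with hw
  -- The second shear carries cell `j` to cell `s'` up to an error `e₂` of size at most `δ/3`. This
  -- is why `goodSet` asks for the margin `δ`: at least `δ/2` survives, enough to evaluate `ψ₃`
  -- without a further exceptional set.
  have hws : w - s' / l = x - j / l + e₂ := by
    have : (s' : ℝ) = j + r - ε' * l := by linarith
    rw [hw, he₂, this]
    field_simp
    ring
  have he2' := abs_le.1 hψ₂
  have hw1 : δ / 2 < w - s' / l := by rw [hws]; linarith
  have hw2 : δ / 2 < (s' + 1) / l - w := by
    have h3 : (s' + 1) / l - w = (j + 1) / l - x - e₂ := by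
      have e1 : (s' + 1 : ℝ) / l = s' / l + 1 / l := add_div _ _ _
      have e3 : (j + 1 : ℝ) / l = j / l + 1 / l := add_div _ _ _
      linarith
    rw [h3]; linarith
  have hsl' : (s' : ℝ) + 1 ≤ l := by exact_mod_cast hsl
  have hwm : w ∈ Set.Ico (0 : ℝ) 1 := by
    have h4 : (0 : ℝ) ≤ s' / l := by positivity
    have h5 : (s' + 1 : ℝ) / l ≤ 1 := by rwa [div_le_one hl']
    exact ⟨by linarith, by linarith⟩
  have hwb : (w : UnitAddCircle) = b := by
    rw [hb, ← hxu, ← AddCircle.coe_add]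
    exact circle_coe_eq_coe_iff.2 ⟨-ε', by rw [hw]; push_cast; ring⟩
  have hψ₃ : |c.ψ₃ b - s' / ((l : ℝ) ^ 2 * q)| ≤ δ / 3 := by
    have hc1 : (s' : ℝ) ≤ l * (1 : ℕ) * w := by
      have : (s' : ℝ) / l ≤ w := by linarith
      rw [div_le_iff₀ hl'] at this
      push_cast; linarith
    have hc2 : (l : ℝ) * (1 : ℕ) * w < s' + 1 := by
      have : w < (s' + 1 : ℝ) / l := by linarith
      rw [lt_div_iff₀ hl'] at this
      push_cast; linarith
    have := hc.approx₃.near' hwm (I := s') (fun m hm => ?_) hc1 hc2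
    · rw [hwb, Nat.mod_eq_of_lt hsl] at this
      exact this
    · refine hsmall.trans_lt ?_
      simp only [Nat.cast_one, mul_one]
      rcases Nat.lt_or_ge s' m with h | h
      · have h6 : (s' + 1 : ℝ) / l ≤ m / l := by
          gcongr
          exact_mod_cast h
        rw [abs_sub_comm]
        exact lt_of_lt_of_le (by linarith) (le_abs_self _)
      · have h6 : (m : ℝ) / l ≤ s' / l := by gcongr
        exact lt_of_lt_of_le (by linarith) (le_abs_self _)
  set e₃ := c.ψ₃ b - s' / ((l : ℝ) ^ 2 * q) with he₃
  have hy : (c.h q u).1 = a + ((-c.ψ₃ b : ℝ) : UnitAddCircle) := rfl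
  have hcell : ∀ m : ℝ, 0 ≤ m → m ≤ l → 0 ≤ m / ((l : ℝ) ^ 2 * q) ∧
      m / ((l : ℝ) ^ 2 * q) ≤ 1 / (l * q) := by
    intro m h0 hm
    refine ⟨by positivity, ?_⟩
    rw [div_le_div_iff₀ (by positivity) (by positivity)]
    calc m * (l * q) ≤ l * (l * q) := by gcongr
      _ = 1 * (l ^ 2 * q) := by ring
  have hδ' : δ ≤ 1 / (l * q) := by
    refine hδle.trans (hcell 1 zero_le_one hl1).2
  constructor
  · have e : (c.h q u).1 - u.1 = ((c.ψ₁ u.2 - c.ψ₃ b : ℝ) : UnitAddCircle) := by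
      rw [hy, ha, AddCircle.coe_neg, AddCircle.coe_sub]
      abel
    rw [dist_eq_norm, e]
    refine (norm_circle_coe_le _).trans ?_
    have hA : 0 ≤ (if j = 0 then 0 else ((l : ℝ) - j) / ((l : ℝ) ^ 2 * q)) ∧
        (if j = 0 then 0 else ((l : ℝ) - j) / ((l : ℝ) ^ 2 * q)) ≤ 1 / (l * q) := by
      split_ifs
      · exact ⟨le_rfl, by positivity⟩
      · have : (j : ℝ) ≤ l := by exact_mod_cast hjl.le
        exact hcell _ (by linarith) (by linarith [j.cast_nonneg (α := ℝ)])
    have hB := hcell s' (by positivity) (by linarith)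
    have h1 := abs_le.1 hψ₁
    have h2 := abs_le.1 hψ₃
    have h3 : (2 : ℝ) / (l * q) = 1 / (l * q) + 1 / (l * q) := by ring
    rw [h3, abs_le]
    constructor <;> linarith [h1.1, h1.2, h2.1, h2.2, hA.1, hA.2, hB.1, hB.2]
  · obtain ⟨t, ht⟩ : ∃ t : ℕ, i = l * t + r := ⟨i / l, (Nat.div_add_mod i l).symm⟩
    have hi' : (i : ℝ) = l * t + r := by exact_mod_cast ht
    have e : u.2 + (l * q) • (c.h q u).1 =
        (((l : ℝ) * (l * q : ℕ) * v - i) / l + (x - j / l) - l * q * e₃ : ℝ) := by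
      rw [hy, ← hva, ← hxu, ← AddCircle.coe_add, ← AddCircle.coe_nsmul, ← AddCircle.coe_add]
      -- Here `i / l = t + r / l` and `s' / l = (j + r) / l - ε'`: the index `r` cancels and `-j /
      -- l` is left to compensate `x`. The three remaining terms are each at most `1 / l`.
      refine circle_coe_eq_coe_iff.2 ⟨t + ε', ?_⟩
      have h7 : c.ψ₃ b = e₃ + s' / ((l : ℝ) ^ 2 * q) := by rw [he₃]; ring
      have h8 : (s' : ℝ) = j + r - ε' * l := by linarith
      rw [nsmul_eq_mul, h7, hi', h8]
      push_cast
      field_simp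
      ring
    rw [e]
    refine (norm_circle_coe_le _).trans ?_
    have f1 : |((l : ℝ) * (l * q : ℕ) * v - i) / l| ≤ 1 / l := by
      rw [abs_div, abs_of_pos hl', abs_of_nonneg (by linarith)]
      gcongr
      linarith
    have f2 : |x - j / l| ≤ 1 / l := by
      rw [abs_of_nonneg (by linarith)]
      have e3 : (j + 1 : ℝ) / l = j / l + 1 / l := add_div _ _ _
      linarith
    have f3 : |(l : ℝ) * q * e₃| ≤ 1 / l := by
      rw [abs_mul, abs_of_pos (by positivity)]
      calc (l : ℝ) * q * |e₃| ≤ l * q * (1 / ((l : ℝ) ^ 2 * q)) := by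
            gcongr
            linarith
        _ = 1 / l := by field_simp
    calc |((l : ℝ) * (l * q : ℕ) * v - i) / l + (x - j / l) - l * q * e₃|
        ≤ |((l : ℝ) * (l * q : ℕ) * v - i) / l| + |x - j / l| + |(l : ℝ) * q * e₃| :=
          (abs_sub _ _).trans (add_le_add_left (abs_add_le _ _) _)
      _ ≤ 1 / l + 1 / l + 1 / l := by linarith
      _ = 3 / l := by ring

instance : IsProbabilityMeasure (volume : Measure UnitAddCircle) := ⟨UnitAddCircle.measure_univ⟩

/-- The first condition removes `l + 1` arcs of length at most `2δ`. The second removes `N + 1` arcs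
of length at most `δ/N`, with `N = l² q`, pulled back by a measure preserving shear. The total is at
most `6 l δ`, and the factor `2^(l² q)` in `1/δ` makes `l δ ≤ (1/2)^q`. -/
theorem volume_goodSet_compl_le {c : Choice} {q : ℕ} (hl : 0 < c.l) (hq : 0 < q)
    (hψ : Measurable c.ψ₁) :
    volume (goodSet c q)ᶜ ≤ ENNReal.ofReal (6 * (1 / 2) ^ q) := by
  set l := c.l with hldef
  have hl1 : (1 : ℝ) ≤ l := by exact_mod_cast hl
  have hl' : (0 : ℝ) < l := by exact_mod_cast hl
  have hq1 : (1 : ℝ) ≤ q := by exact_mod_cast hq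
  have hδ := errDelta_pos hl hq
  set δ := errDelta l q with hδdef
  have hball : ∀ (r : ℝ) (y : UnitAddCircle), volume (Metric.closedBall y r) ≤ ENNReal.ofReal (2 * r) := by
    intro r y
    rw [AddCircle.volume_closedBall]
    exact ENNReal.ofReal_le_ofReal (min_le_right _ _)
  have hunion : ∀ (N : ℕ) (r : ℝ) (y : ℕ → UnitAddCircle), 0 ≤ r →
      volume (⋃ i ∈ Finset.range (N + 1), Metric.closedBall (y i) r) ≤
        ENNReal.ofReal ((N + 1) * (2 * r)) := by
    intro N r y hr
    refine (measure_biUnion_finset_le _ _).trans ((Finset.sum_le_sum fun i _ => hball r (y i)).trans ?_)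
    rw [Finset.sum_const, Finset.card_range, nsmul_eq_mul]
    refine le_of_eq ?_
    rw [show (N : ℝ) + 1 = ((N + 1 : ℕ) : ℝ) by push_cast; ring,
      ENNReal.ofReal_mul (p := ((N + 1 : ℕ) : ℝ)) (by positivity),
      ENNReal.ofReal_natCast]
  set B₂ : Set UnitAddCircle := ⋃ j ∈ Finset.range (l + 1),
    Metric.closedBall ((j / l : ℝ) : UnitAddCircle) δ with hB₂
  set B₁ : Set UnitAddCircle := ⋃ i ∈ Finset.range (l * (l * q) + 1),
    Metric.closedBall ((i / (l * (l * q : ℕ)) : ℝ) : UnitAddCircle) (δ / (2 * l * (l * q : ℕ))) with hB₁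
  have hB₁m : MeasurableSet B₁ := Finset.measurableSet_biUnion _ fun _ _ => Metric.isClosed_closedBall.measurableSet
  have hB₂m : MeasurableSet B₂ := Finset.measurableSet_biUnion _ fun _ _ => Metric.isClosed_closedBall.measurableSet
  have hsub : (goodSet c q)ᶜ ⊆ Prod.snd ⁻¹' B₂ ∪ (Prod.fst ∘ shearFst c.ψ₁) ⁻¹' B₁ := by
    intro u hu
    by_contra hcon
    simp only [Set.mem_union, Set.mem_preimage, not_or, hB₁, hB₂, Set.mem_iUnion, not_exists,
      Finset.mem_range, Metric.mem_closedBall, not_le, Nat.lt_succ_iff] at hcon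
    exact hu ⟨hcon.1, hcon.2⟩
  have hm₂ : volume (Prod.snd ⁻¹' B₂ : Set Torus) = volume B₂ :=
    (measurePreserving_snd (μ := (volume : Measure UnitAddCircle))
      (ν := (volume : Measure UnitAddCircle))).measure_preimage hB₂m.nullMeasurableSet
  have hm₁ : volume ((Prod.fst ∘ shearFst c.ψ₁) ⁻¹' B₁ : Set Torus) = volume B₁ :=
    ((measurePreserving_fst (μ := (volume : Measure UnitAddCircle))
      (ν := (volume : Measure UnitAddCircle))).comp
        (measurePreserving_shearFst hψ)).measure_preimage hB₁m.nullMeasurableSet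
  refine (measure_mono hsub).trans ((measure_union_le _ _).trans ?_)
  rw [hm₂, hm₁]
  refine (add_le_add (hunion l δ _ hδ.le) (hunion _ _ _ (by positivity))).trans ?_
  rw [← ENNReal.ofReal_add (by positivity) (by positivity)]
  refine ENNReal.ofReal_le_ofReal ?_
  have hN : (1 : ℝ) ≤ (l * (l * q) : ℕ) := by exact_mod_cast Nat.mul_pos hl (Nat.mul_pos hl hq)
  have h1 : (((l * (l * q) : ℕ) : ℝ) + 1) * (2 * (δ / (2 * l * (l * q : ℕ)))) ≤ 2 * δ := by
    have : (2 : ℝ) * (δ / (2 * l * (l * q : ℕ))) = δ / (l * (l * q) : ℕ) := by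
      push_cast; field_simp
    rw [this, ← mul_div_assoc, div_le_iff₀ (by positivity)]
    nlinarith
  have h2 : ((l : ℝ) + 1) * (2 * δ) ≤ 4 * (l * δ) := by nlinarith
  have h3 : δ ≤ l * δ := by nlinarith
  have h4 : l * δ ≤ (1 / 2) ^ q := by
    have h5 : (2 : ℝ) ^ q ≤ 2 ^ (l ^ 2 * q) :=
      pow_le_pow_right₀ (by norm_num) (Nat.le_mul_of_pos_left q (by positivity))
    rw [hδdef, errDelta, one_div_pow, mul_one_div, div_le_div_iff₀ (by positivity) (by positivity)]
    have h6 : (l : ℝ) * 1 ≤ l ^ 2 * q := by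
      rw [pow_two, mul_assoc]
      gcongr
      nlinarith
    calc (l : ℝ) * 2 ^ q ≤ (l ^ 2 * q) * 2 ^ (l ^ 2 * q) := by
          gcongr
          linarith
      _ = 1 * (2 ^ (l ^ 2 * q) * (l ^ 2 * q)) := by ring
  linarith

/-! ### Running the construction -/

/-- The properties of the stages that every step of the construction preserves. -/
structure Stage.Regular (s : Stage) : Prop where
  q_pos : 0 < s.q
  lift : Nonempty (EntireLift s.H)
  measurePreserving : MeasurePreserving s.H volume volume

/-- The stage that follows `s` when `k`, `l` and `h_{n+1} = h` are chosen. -/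
def Stage.succ (s : Stage) (k l : ℕ) (h : Torus ≃ Torus) : Stage :=
  ⟨k * l ^ 2 * s.p + 1, k * l ^ 2 * s.q, s.H.trans h⟩

theorem Stage.T_eq_conjFlow (s : Stage) : s.T = conjFlow s.H s.alpha := rfl

theorem Stage.alpha_succ {s : Stage} {k l : ℕ} (h : Torus ≃ Torus) (hq : 0 < s.q) (hk : 0 < k)
    (hl : 0 < l) : (s.succ k l h).alpha = s.alpha + 1 / (k * l ^ 2 * s.q) := by
  have : (0 : ℝ) < s.q := by exact_mod_cast hq
  have : (0 : ℝ) < k := by exact_mod_cast hk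
  have : (0 : ℝ) < l := by exact_mod_cast hl
  simp only [Stage.alpha, Stage.succ]
  push_cast
  field_simp

theorem tendsto_alpha_succ {s : Stage} {l : ℕ} (h : Torus ≃ Torus) (hq : 0 < s.q) (hl : 0 < l) :
    Tendsto (fun k => (s.succ k l h).alpha) atTop (𝓝 s.alpha) := by
  have hq' : (0 : ℝ) < s.q := by exact_mod_cast hq
  have hl' : (0 : ℝ) < l := by exact_mod_cast hl
  have h1 : Tendsto (fun k : ℕ => s.alpha + 1 / ((l : ℝ) ^ 2 * s.q) * (1 / (k : ℝ))) atTop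
      (𝓝 (s.alpha + 1 / ((l : ℝ) ^ 2 * s.q) * 0)) :=
    (tendsto_one_div_atTop_nhds_zero_nat.const_mul _).const_add _
  rw [mul_zero, add_zero] at h1
  refine h1.congr' ?_
  filter_upwards [eventually_gt_atTop 0] with k hk
  rw [Stage.alpha_succ h hq hk hl]
  have : (0 : ℝ) < k := by exact_mod_cast hk
  field_simp

theorem IsStepApprox.isEntire {k N : ℕ} {a : ℕ → ℝ} {ε δ : ℝ} {s : UnitAddCircle → ℝ}
    (h : IsStepApprox k N a ε δ s) : IsEntire s := h.entire

namespace Choice.Admissible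

variable {c : Choice} {n : ℕ} {s : Stage}

theorem l_pos (hc : c.Admissible n s) : 0 < c.l := by
  have := (zero_le (a := (2 : ℝ≥0∞) ^ n * derivSup s.H)).trans_lt hc.l_large
  exact_mod_cast this

theorem derivSup_le (hc : c.Admissible n s) :
    derivSup s.H ≤ ENNReal.ofReal (c.l * (1 / 2) ^ n) := by
  have h2 : ENNReal.ofReal (c.l * (1 / 2) ^ n) = (2 ^ n)⁻¹ * c.l := by
    rw [ENNReal.ofReal_mul (by positivity), ENNReal.ofReal_natCast, mul_comm, one_div, inv_pow,
      ENNReal.ofReal_inv_of_pos (by positivity), ENNReal.ofReal_pow (by norm_num),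
      ENNReal.ofReal_ofNat]
  rw [h2]
  refine (ENNReal.mul_le_iff_le_inv (by simp) (by simp)).1 hc.l_large.le

theorem nonempty_entireLift_h (hc : c.Admissible n s) : Nonempty (EntireLift (c.h s.q)) := by
  obtain ⟨L₁⟩ := nonempty_entireLift_shearFst hc.approx₁.isEntire
  obtain ⟨L₂⟩ := nonempty_entireLift_shearSnd hc.approx₂.isEntire
  obtain ⟨L₃⟩ := nonempty_entireLift_shearFst hc.approx₃.isEntire.neg
  obtain ⟨L₄⟩ := nonempty_entireLift_twist s.q
  exact ⟨((L₁.trans L₂).trans L₃).trans L₄⟩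

theorem measurePreserving_h (hc : c.Admissible n s) :
    MeasurePreserving (c.h s.q) volume volume :=
  (measurePreserving_twist s.q).comp
    ((measurePreserving_shearFst hc.approx₃.isEntire.neg.continuous.measurable).comp
      ((measurePreserving_shearSnd hc.approx₂.isEntire.continuous.measurable).comp
        (measurePreserving_shearFst hc.approx₁.isEntire.continuous.measurable)))

theorem regular_next (hc : c.Admissible n s) (hs : s.Regular) : (s.next c).Regular where
  q_pos := Nat.mul_pos (Nat.mul_pos hc.k_pos (pow_pos hc.l_pos 2)) hs.q_pos
  lift := by
    obtain ⟨L⟩ := hs.lift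
    obtain ⟨M⟩ := hc.nonempty_entireLift_h
    exact ⟨L.trans M⟩
  measurePreserving := hc.measurePreserving_h.comp hs.measurePreserving

/-- `h_{n+1}` commutes with `φ^{α_n}`. -/
theorem h_flow (hc : c.Admissible n s) (hq : 0 < s.q) (u : Torus) :
    c.h s.q (flow s.alpha u) = flow s.alpha (c.h s.q u) := by
  have hq' : (0 : ℝ) < s.q := by exact_mod_cast hq
  have hl' : (0 : ℝ) < c.l := by exact_mod_cast hc.l_pos
  have h2 : ∀ x : UnitAddCircle, c.ψ₂ (x + (s.alpha : UnitAddCircle)) = c.ψ₂ x := by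
    intro x
    obtain ⟨y, rfl⟩ := QuotientAddGroup.mk_surjective x
    have := hc.approx₂.periodic.nat_mul (s.p * c.l) y
    have e : ((s.p * c.l : ℕ) : ℝ) * (1 / ((c.l * s.q : ℕ) : ℝ)) = s.alpha := by
      rw [Stage.alpha]
      push_cast
      field_simp
    rw [e] at this
    simpa using this
  have h4 : s.q • (s.alpha : UnitAddCircle) = 0 := by
    rw [← AddCircle.coe_nsmul, AddCircle.coe_eq_zero_iff]
    refine ⟨s.p, ?_⟩
    rw [Stage.alpha, nsmul_eq_mul, mul_div_cancel₀ _ hq'.ne']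
    simp
  have e : ∀ x a : UnitAddCircle, x + (s.alpha : UnitAddCircle) + a = x + a + s.alpha :=
    fun x a => add_right_comm x _ a
  ext
  · simp only [Choice.h, flow, shearFst, shearSnd, twist, Equiv.trans_apply, Equiv.coe_fn_mk]
    simp only [e, h2]
  · simp only [Choice.h, flow, shearFst, shearSnd, twist, Equiv.trans_apply, Equiv.coe_fn_mk]
    simp only [e, h2, smul_add, h4, add_zero]

/-- By commutation the new conjugating map leaves `T_n` unchanged, so passing to `T_{n+1}` changes
only the rotation number. -/
theorem conjFlow_eq (hc : c.Admissible n s) (hq : 0 < s.q) :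
    conjFlow (s.H.trans (c.h s.q)) s.alpha = s.T := by
  ext1 u
  rw [conjFlow_apply, Stage.T_eq_conjFlow, conjFlow_apply, Equiv.symm_apply_eq]
  simp only [Equiv.trans_apply, Equiv.apply_symm_apply]
  exact (hc.h_flow hq _).symm

end Choice.Admissible

/-- The distances required of consecutive `T_n`. -/
def rate (n l q : ℕ) : ℝ := (1 / 4) ^ n / (l * q)

/-- All `k ≥ K` make the next map and its inverse close to the present ones. -/
def IsCloseFrom (n : ℕ) (s : Stage) (l : ℕ) (h : Torus ≃ Torus) (K : ℕ) : Prop :=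
  ∀ k ≥ K, analyticDist (n + 1) s.T (s.succ k l h).T < ENNReal.ofReal (rate n l s.q) ∧
    analyticDist (n + 1) s.T.symm (s.succ k l h).T.symm < ENNReal.ofReal (rate n l s.q)

/-- `H_{n+1}` does not involve `k`, while the next rotation number tends to `α_n` as `k → ∞`; the
inverses are the same conjugates at time `-α`. -/
theorem Choice.Admissible.exists_isCloseFrom {c : Choice} {n : ℕ} {s : Stage}
    (hc : c.Admissible n s) (hs : s.Regular) : ∃ K, IsCloseFrom n s c.l (c.h s.q) K := by
  obtain ⟨L⟩ := hs.lift
  obtain ⟨M⟩ := hc.nonempty_entireLift_h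
  have hr : (0 : ℝ≥0∞) < ENNReal.ofReal (rate n c.l s.q) := by
    have : (0 : ℝ) < s.q := by exact_mod_cast hs.q_pos
    have : (0 : ℝ) < c.l := by exact_mod_cast hc.l_pos
    rw [ENNReal.ofReal_pos, rate]
    positivity
  have ht := tendsto_alpha_succ (c.h s.q) hs.q_pos hc.l_pos
  have h1 := (((L.trans M).tendsto_analyticDist s.alpha (n + 1)).comp ht).eventually (gt_mem_nhds hr)
  have h2 := (((L.trans M).tendsto_analyticDist (-s.alpha) (n + 1)).comp ht.neg).eventually
    (gt_mem_nhds hr)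
  obtain ⟨K, hK⟩ := eventually_atTop.1 (h1.and h2)
  refine ⟨K, fun k hk => ?_⟩
  obtain ⟨h3, h4⟩ := hK k hk
  simp only [Function.comp_apply] at h3 h4
  rw [← conjFlow_symm, ← conjFlow_symm] at h4
  rw [hc.conjFlow_eq hs.q_pos] at h3 h4
  exact ⟨h3, h4⟩

/-- A threshold that makes the `T_n` converge to a map isomorphic to an irrational rotation. -/
def goodThreshold : Threshold := fun n s l h =>
  open Classical in
  -- For an admissible choice at a regular stage the second branch does not occur. The term `n + 2`
  -- serves irrationality and the growth of `q_n`.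
  if hK : ∃ K, IsCloseFrom n s l h K then max (n + 2) hK.choose else n + 2

theorem le_goodThreshold (n : ℕ) (s : Stage) (l : ℕ) (h : Torus ≃ Torus) :
    n + 2 ≤ goodThreshold n s l h := by
  unfold goodThreshold
  split_ifs
  · exact le_max_left _ _
  · exact le_rfl

theorem isCloseFrom_goodThreshold {n : ℕ} {s : Stage} {l : ℕ} {h : Torus ≃ Torus}
    (hK : ∃ K, IsCloseFrom n s l h K) : IsCloseFrom n s l h (goodThreshold n s l h) := by
  intro k hk
  rw [goodThreshold, dif_pos hK] at hk
  exact hK.choose_spec k ((le_max_right _ _).trans hk)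

theorem regular_start {p₀ q₀ : ℕ} (h : p₀ < q₀) : Stage.Regular ⟨p₀, q₀, Equiv.refl Torus⟩ :=
  ⟨(Nat.zero_le _).trans_lt h, ⟨EntireLift.refl⟩, MeasurePreserving.id _⟩

theorem exists_admissible {s : Stage} (hs : s.Regular) (n : ℕ) (κ : Threshold) :
    ∃ c : Choice, c.Admissible n s ∧ κ n s c.l (c.h s.q) ≤ c.k := by
  obtain ⟨L⟩ := hs.lift
  obtain ⟨l, hl⟩ := ENNReal.exists_nat_gt
    (ENNReal.mul_lt_top (ENNReal.pow_lt_top (a := 2) (n := n) ENNReal.ofNat_lt_top)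
      L.isLift.derivSup_lt_top).ne
  have hl0 : 0 < l := by
    have := (zero_le (a := (2 : ℝ≥0∞) ^ n * derivSup s.H)).trans_lt hl
    exact_mod_cast this
  have hδ := errDelta_pos hl0 hs.q_pos
  have hε : 0 < errDelta l s.q / 3 := by positivity
  obtain ⟨ψ₁, h₁⟩ := exists_isStepApprox hl0 one_pos
    (fun i => if i = 0 then 0 else ((l : ℝ) - i) / ((l : ℝ) ^ 2 * s.q)) hε hδ
  obtain ⟨ψ₂, h₂⟩ := exists_isStepApprox hl0 (Nat.mul_pos hl0 hs.q_pos)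
    (fun i => (i : ℝ) / l) hε hδ
  obtain ⟨ψ₃, h₃⟩ := exists_isStepApprox hl0 one_pos (fun i => (i : ℝ) / ((l : ℝ) ^ 2 * s.q)) hε hδ
  let c₀ : Choice := ⟨l, 1, ψ₁, ψ₂, ψ₃⟩
  exact ⟨⟨l, max 1 (κ n s l (c₀.h s.q)), ψ₁, ψ₂, ψ₃⟩, ⟨hl, le_max_left _ _, h₁, h₂, h₃⟩,
    le_max_right _ _⟩

theorem exists_isConstruction (κ : Threshold) {p₀ q₀ : ℕ} (h : p₀ < q₀) :
    ∃ c : ℕ → Choice, IsConstruction κ p₀ q₀ c := by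
  choose ch hadm hk using fun (n : ℕ) (s : {s : Stage // s.Regular}) => exists_admissible s.2 n κ
  let st : ℕ → {s : Stage // s.Regular} := fun n =>
    Nat.rec (motive := fun _ => {s : Stage // s.Regular}) ⟨_, regular_start h⟩
      (fun n s => ⟨s.1.next (ch n s), (hadm n s).regular_next s.2⟩) n
  let c : ℕ → Choice := fun n => ch n (st n)
  have hst : ∀ n, stage p₀ q₀ c n = (st n).1 := by
    intro n
    induction n with
    | zero => rfl
    | succ n ih => rw [stage, ih]
  exact ⟨c, h, fun n => by rw [hst]; exact hadm n (st n), fun n => by rw [hst]; exact hk n (st n)⟩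

namespace IsConstruction

variable {κ : Threshold} {p₀ q₀ : ℕ} {c : ℕ → Choice}

theorem regular (hc : IsConstruction κ p₀ q₀ c) (n : ℕ) : (stage p₀ q₀ c n).Regular := by
  induction n with
  | zero => exact regular_start hc.start
  | succ n ih => exact (hc.admissible n).regular_next ih

theorem l_pos (hc : IsConstruction κ p₀ q₀ c) (n : ℕ) : 0 < (c n).l := (hc.admissible n).l_pos

theorem q_succ (n : ℕ) :
    (stage p₀ q₀ c (n + 1)).q = (c n).k * (c n).l ^ 2 * (stage p₀ q₀ c n).q := rfl

end IsConstruction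

/-! ### Limits -/

theorem exists_tendsto_of_dist_le {X : Type*} [MetricSpace X] [CompleteSpace X] {f : ℕ → X}
    {b : ℕ → ℝ} (hb : ∀ n, b (n + 1) ≤ b n / 2) {N : ℕ}
    (h : ∀ n ≥ N, dist (f n) (f (n + 1)) ≤ b n) :
    ∃ a, Tendsto f atTop (𝓝 a) ∧ ∀ n ≥ N, dist (f n) a ≤ 2 * b n := by
  have hbm : ∀ n m, b (n + m) ≤ b n / 2 ^ m := by
    intro n m
    induction m with
    | zero => simp
    | succ m ih =>
      rw [← add_assoc, pow_succ, ← div_div]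
      exact (hb _).trans (by gcongr)
  have hd : ∀ n ≥ N, ∀ m, dist (f (n + m)) (f (n + m + 1)) ≤ 2 * b n / 2 / 2 ^ m := by
    intro n hn m
    rw [mul_div_cancel_left₀ _ two_ne_zero]
    exact (h _ (by omega)).trans (hbm n m)
  obtain ⟨a, ha⟩ := cauchySeq_tendsto_of_complete
    (cauchySeq_of_le_geometric_two (f := fun m => f (N + m)) (hd N le_rfl))
  have ha' : Tendsto f atTop (𝓝 a) := by
    refine (tendsto_add_atTop_iff_nat N).1 (ha.congr fun m => ?_)
    rw [add_comm]
  refine ⟨a, ha', fun n hn => ?_⟩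
  refine dist_le_of_le_geometric_two_of_tendsto₀ (f := fun m => f (n + m)) (hd n hn) ?_
  refine ((tendsto_add_atTop_iff_nat n).2 ha').congr fun m => ?_
  rw [add_comm]

/-- An almost everywhere limit of measure preserving maps is measure preserving. -/
theorem measurePreserving_of_tendsto {X Y : Type*} [MeasurableSpace X] [MeasurableSpace Y]
    [TopologicalSpace Y] [HasOuterApproxClosed Y] [BorelSpace Y] {μ : Measure X} {ν : Measure Y}
    [IsFiniteMeasure μ] [IsFiniteMeasure ν] {f : ℕ → X → Y} {g : X → Y}
    (hf : ∀ n, MeasurePreserving (f n) μ ν) (hg : Measurable g)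
    (h : ∀ᵐ x ∂μ, Tendsto (fun n => f n x) atTop (𝓝 (g x))) : MeasurePreserving g μ ν := by
  refine ⟨hg, ext_of_forall_integral_eq_of_IsFiniteMeasure fun φ => ?_⟩
  have hφ : Measurable φ := φ.continuous.measurable
  have hφs : ∀ ρ : Measure Y, AEStronglyMeasurable φ ρ := fun ρ => hφ.aestronglyMeasurable
  rw [integral_map hg.aemeasurable (hφs _)]
  have h1 : Tendsto (fun n => ∫ x, φ (f n x) ∂μ) atTop (𝓝 (∫ x, φ (g x) ∂μ)) := by
    refine tendsto_integral_of_dominated_convergence (fun _ => ‖φ‖)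
      (fun n => (hφ.comp (hf n).measurable).aestronglyMeasurable) (integrable_const _)
      (fun n => Eventually.of_forall fun x => φ.norm_coe_le_norm _) ?_
    filter_upwards [h] with x hx using (φ.continuous.tendsto _).comp hx
  have h2 : ∀ n, ∫ x, φ (f n x) ∂μ = ∫ y, φ y ∂ν := fun n => by
    rw [← (hf n).map_eq, integral_map (hf n).measurable.aemeasurable (hφs _)]
  exact tendsto_nhds_unique h1 (by simp only [h2]; exact tendsto_const_nhds)

theorem IsDisplacement.continuous_map {T : Torus → Torus} {f : Fin 2 → ℝ × ℝ → ℝ}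
    (hf : IsDisplacement T f) : Continuous T := by
  have hq : Topology.IsQuotientMap proj :=
    (QuotientAddGroup.isOpenQuotientMap_mk.prodMap
      QuotientAddGroup.isOpenQuotientMap_mk).isQuotientMap
  rw [hq.continuous_iff, show T ∘ proj = fun x => proj (x.1 + f 0 x, x.2 + f 1 x) from
    funext hf.lift]
  exact continuous_proj.comp ((continuous_fst.add (hf.continuous 0)).prodMk
    (continuous_snd.add (hf.continuous 1)))

theorem IsDisplacement.isAnalyticLift {T : Torus → Torus} {f : Fin 2 → ℝ × ℝ → ℝ}
    (hf : IsDisplacement T f) {ρ : ℝ} (h : ∀ i, MemAnalytic ρ (f i)) :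
    IsAnalyticLift T fun x => (x.1 + f 0 x, x.2 + f 1 x) where
  analytic x _ := (analyticAt_fst.add ((h 0).analytic x trivial)).prod
    (analyticAt_snd.add ((h 1).analytic x trivial))
  lift x := (hf.lift x).symm

theorem EntireLift.continuous_symm {H : Torus ≃ Torus} (L : EntireLift H) : Continuous H.symm := by
  obtain ⟨D, hD⟩ := L.isLift'.exists_fderiv_bound
  have hD0 : 0 ≤ D := (norm_nonneg _).trans (hD 0)
  exact (LipschitzWith.of_dist_le_mul (K := ⟨D, hD0⟩) (L.isLift'.dist_le hD)).continuous

theorem Stage.Regular.continuous_symm {s : Stage} (hs : s.Regular) : Continuous s.H.symm :=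
  hs.lift.some.continuous_symm

theorem Stage.Regular.measurePreserving_conjFlow {s : Stage} (hs : s.Regular) (t : ℝ) :
    MeasurePreserving (conjFlow s.H t) volume volume := by
  have hm := hs.continuous_symm.measurable
  have hsymm : MeasurePreserving s.H.symm volume volume := by
    refine ⟨hm, ?_⟩
    have h := hs.measurePreserving
    conv_lhs => rw [← h.map_eq, Measure.map_map hm h.measurable]
    simp
  exact hsymm.comp ((measurePreserving_shearFst measurable_const).comp hs.measurePreserving)

theorem Stage.Regular.hasTameDisplacement_conjFlow {s : Stage} (hs : s.Regular) (t : ℝ) :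
    HasTameDisplacement (conjFlow s.H t) :=
  hs.lift.some.hasTameDisplacement t

theorem Stage.Regular.memDiff {s : Stage} (hs : s.Regular) {ρ : ℝ} (hρ : 0 < ρ) : MemDiff ρ s.T where
  diffeo := (nonempty_entireLift_conjFlow hs.lift.some s.alpha).some.isAnalyticDiffeo
  measurePreserving := hs.measurePreserving_conjFlow s.alpha
  displacement := (hs.hasTameDisplacement_conjFlow s.alpha).exists_memAnalytic hρ

namespace IsConstruction

variable {p₀ q₀ : ℕ} {c : ℕ → Choice}

theorem add_two_le_k (hc : IsConstruction goodThreshold p₀ q₀ c) (n : ℕ) : n + 2 ≤ (c n).k :=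
  (le_goodThreshold _ _ _ _).trans (hc.k_large n)

theorem q_pos (hc : IsConstruction goodThreshold p₀ q₀ c) (n : ℕ) :
    (0 : ℝ) < (stage p₀ q₀ c n).q := by
  exact_mod_cast (hc.regular n).q_pos

theorem one_le_l (hc : IsConstruction goodThreshold p₀ q₀ c) (n : ℕ) : (1 : ℝ) ≤ (c n).l := by
  exact_mod_cast hc.l_pos n

theorem q_succ_real (n : ℕ) : ((stage p₀ q₀ c (n + 1)).q : ℝ) =
    (c n).k * (c n).l ^ 2 * (stage p₀ q₀ c n).q := by
  rw [q_succ]; push_cast; ring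

theorem two_mul_q_le (hc : IsConstruction goodThreshold p₀ q₀ c) (n : ℕ) :
    2 * (c n).l ^ 2 * ((stage p₀ q₀ c n).q : ℝ) ≤ (stage p₀ q₀ c (n + 1)).q := by
  rw [q_succ_real]
  have h1 : (2 : ℝ) ≤ (c n).k := by exact_mod_cast (Nat.le_add_left 2 n).trans (hc.add_two_le_k n)
  gcongr

theorem q_le_succ (hc : IsConstruction goodThreshold p₀ q₀ c) (n : ℕ) :
    2 * ((stage p₀ q₀ c n).q : ℝ) ≤ (stage p₀ q₀ c (n + 1)).q := by
  refine le_trans ?_ (hc.two_mul_q_le n)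
  have := one_le_pow₀ (hc.one_le_l n) (n := 2)
  have := hc.q_pos n
  gcongr
  nlinarith

theorem l_le_q_succ (hc : IsConstruction goodThreshold p₀ q₀ c) (n : ℕ) :
    ((c n).l : ℝ) ≤ (stage p₀ q₀ c (n + 1)).q := by
  refine le_trans ?_ (hc.two_mul_q_le n)
  have h1 := hc.one_le_l n
  have h2 : (1 : ℝ) ≤ (stage p₀ q₀ c n).q := by exact_mod_cast (hc.regular n).q_pos
  calc ((c n).l : ℝ) = 1 * ((c n).l * 1) * 1 := by ring
    _ ≤ 2 * ((c n).l * (c n).l) * (stage p₀ q₀ c n).q := by gcongr; norm_num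
    _ = _ := by ring

theorem q_monotone (hc : IsConstruction goodThreshold p₀ q₀ c) :
    Monotone fun n => ((stage p₀ q₀ c n).q : ℝ) :=
  monotone_nat_of_le_succ fun n => by linarith [hc.q_le_succ n, hc.q_pos n]

/-- This crude growth makes the measures `(1/2)^(q_n)` summable. -/
theorem le_q (hc : IsConstruction goodThreshold p₀ q₀ c) (n : ℕ) : n ≤ (stage p₀ q₀ c n).q := by
  induction n with
  | zero => exact Nat.zero_le _
  | succ n ih =>
    have h1 : 2 * (stage p₀ q₀ c n).q ≤ (stage p₀ q₀ c (n + 1)).q := by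
      exact_mod_cast hc.q_le_succ n
    have := (hc.regular n).q_pos
    omega

/-- The denominators of all later rates dominate `l_n`, so the whole tail of rates carries a factor
`1/l_n`. This offsets the Lipschitz constant of `H_n`, which is of order `l_n / 2^n`. -/
theorem l_le_l_mul_q (hc : IsConstruction goodThreshold p₀ q₀ c) (n m : ℕ) :
    ((c n).l : ℝ) ≤ (c (m + n)).l * (stage p₀ q₀ c (m + n)).q := by
  have hl := hc.one_le_l
  rcases m with _ | m
  · have h2 : (1 : ℝ) ≤ (stage p₀ q₀ c (0 + n)).q := by exact_mod_cast (hc.regular _).q_pos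
    rw [zero_add] at h2 ⊢
    exact le_mul_of_one_le_right (by linarith [hl n]) h2
  · have h2 : ((stage p₀ q₀ c (n + 1)).q : ℝ) ≤ (stage p₀ q₀ c (m + 1 + n)).q :=
      hc.q_monotone (by omega)
    exact (hc.l_le_q_succ n).trans (h2.trans (le_mul_of_one_le_left (hc.q_pos _).le (hl _)))

theorem inv_q_succ_le (hc : IsConstruction goodThreshold p₀ q₀ c) {C : ℝ} (hC : 0 ≤ C) (n : ℕ) :
    C / (stage p₀ q₀ c (n + 1)).q ≤ C / (stage p₀ q₀ c n).q / 2 := by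
  have h1 := hc.q_pos n
  rw [div_div, mul_comm _ (2 : ℝ)]
  exact div_le_div_of_nonneg_left hC (by positivity) (hc.q_le_succ n)

theorem rate_le (hc : IsConstruction goodThreshold p₀ q₀ c) (n m : ℕ) :
    rate (m + n) (c (m + n)).l (stage p₀ q₀ c (m + n)).q ≤
      (1 / 4) ^ n / (c n).l * (1 / 4) ^ m := by
  have h1 := hc.one_le_l n
  calc rate (m + n) (c (m + n)).l (stage p₀ q₀ c (m + n)).q
      ≤ (1 / 4) ^ (m + n) / (c n).l :=
        div_le_div_of_nonneg_left (by positivity) (by linarith) (hc.l_le_l_mul_q n m)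
    _ = _ := by rw [pow_add]; ring

theorem rate_nonneg (n l q : ℕ) : 0 ≤ rate n l q := by unfold rate; positivity

theorem summable_rate (hc : IsConstruction goodThreshold p₀ q₀ c) :
    Summable fun n => rate n (c n).l (stage p₀ q₀ c n).q := by
  refine Summable.of_nonneg_of_le (fun n => rate_nonneg _ _ _) (fun n => hc.rate_le 0 n)
    ((summable_geometric_of_lt_one (by norm_num) (by norm_num)).mul_left _)

theorem tsum_rate_le (hc : IsConstruction goodThreshold p₀ q₀ c) (n : ℕ) :
    ∑' m, rate (m + n) (c (m + n)).l (stage p₀ q₀ c (m + n)).q ≤ 2 * ((1 / 4) ^ n / (c n).l) := by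
  have hg : Summable fun m : ℕ => (1 / 4 : ℝ) ^ m :=
    summable_geometric_of_lt_one (by norm_num) (by norm_num)
  have h1 := hc.one_le_l n
  refine (((summable_nat_add_iff n).2 hc.summable_rate).tsum_le_tsum (hc.rate_le n)
    (hg.mul_left _)).trans ?_
  rw [tsum_mul_left, tsum_geometric_of_lt_one (by norm_num) (by norm_num), mul_comm]
  have : 0 ≤ (1 / 4 : ℝ) ^ n / (c n).l := by positivity
  gcongr
  norm_num

theorem alpha_succ (hc : IsConstruction goodThreshold p₀ q₀ c) (n : ℕ) :
    (stage p₀ q₀ c (n + 1)).alpha = (stage p₀ q₀ c n).alpha + 1 / (stage p₀ q₀ c (n + 1)).q := by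
  rw [q_succ_real]
  exact Stage.alpha_succ _ (hc.regular n).q_pos (hc.admissible n).k_pos (hc.l_pos n)

theorem exists_alpha (hc : IsConstruction goodThreshold p₀ q₀ c) :
    ∃ α : ℝ, Tendsto (fun n => (stage p₀ q₀ c n).alpha) atTop (𝓝 α) ∧ Irrational α := by
  have hd : ∀ n ≥ 0, dist (stage p₀ q₀ c n).alpha (stage p₀ q₀ c (n + 1)).alpha ≤
      1 / (stage p₀ q₀ c (n + 1)).q := by
    intro n _
    rw [hc.alpha_succ n, Real.dist_eq, sub_add_cancel_left, abs_neg, abs_of_nonneg (by positivity)]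
  obtain ⟨α, hα, hαd⟩ := exists_tendsto_of_dist_le
    (b := fun n => 1 / (stage p₀ q₀ c (n + 1)).q)
    (fun n => hc.inv_q_succ_le zero_le_one (n + 1)) hd
  refine ⟨α, hα, ?_⟩
  have hlt : ∀ n, (stage p₀ q₀ c n).alpha < (stage p₀ q₀ c (n + 1)).alpha := by
    intro n
    rw [hc.alpha_succ n]
    have := hc.q_pos (n + 1)
    exact lt_add_of_pos_right _ (by positivity)
  have hpos : ∀ n, (stage p₀ q₀ c n).alpha < α := fun n =>
    (hlt n).trans_le ((monotone_nat_of_le_succ fun n => (hlt n).le).ge_of_tendsto hα (n + 1))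
  rintro ⟨r, rfl⟩
  -- If `α` had denominator `b`, then `α - α_n`, being positive, would be at least `1/(b q_n)`. It
  -- is at most `2/((n + 2) q_n)`, so `n + 2 ≤ 2b`, which fails for `n = 2b`.
  set n := 2 * r.den with hn
  have hq := hc.q_pos n
  have hden : (0 : ℝ) < r.den := by exact_mod_cast r.den_pos
  have h1 : (r : ℝ) - (stage p₀ q₀ c n).alpha ≤ 2 * (1 / (stage p₀ q₀ c (n + 1)).q) := by
    have := hαd n (Nat.zero_le n)
    rw [Real.dist_eq, abs_sub_comm] at this
    exact (le_abs_self _).trans this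
  have h2 : 2 * (1 / ((stage p₀ q₀ c (n + 1)).q : ℝ)) ≤ 2 / ((n + 2) * (stage p₀ q₀ c n).q) := by
    rw [mul_one_div]
    refine div_le_div_of_nonneg_left (by norm_num) (by positivity) ?_
    rw [q_succ_real]
    have h3 : ((n : ℝ) + 2) ≤ (c n).k := by exact_mod_cast hc.add_two_le_k n
    have h4 := one_le_pow₀ (hc.one_le_l n) (n := 2)
    calc ((n : ℝ) + 2) * (stage p₀ q₀ c n).q = (n + 2) * 1 * (stage p₀ q₀ c n).q := by ring
      _ ≤ _ := by gcongr
  have h5 : (r : ℝ) - (stage p₀ q₀ c n).alpha =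
      ((r.num * (stage p₀ q₀ c n).q - (stage p₀ q₀ c n).p * r.den : ℤ) : ℝ) /
        (r.den * (stage p₀ q₀ c n).q) := by
    rw [Stage.alpha]
    conv_lhs => rw [Rat.cast_def r]
    push_cast
    field_simp
  have h6 : (1 : ℝ) ≤ ((r.num * (stage p₀ q₀ c n).q - (stage p₀ q₀ c n).p * r.den : ℤ) : ℝ) := by
    have h7 := sub_pos.2 (hpos n)
    rw [h5, lt_div_iff₀ (by positivity), zero_mul] at h7
    exact_mod_cast h7
  have h8 : 1 / (r.den * (stage p₀ q₀ c n).q : ℝ) ≤ 2 / ((n + 2) * (stage p₀ q₀ c n).q) :=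
    ((div_le_div_of_nonneg_right h6 (by positivity)).trans_eq h5.symm).trans (h1.trans h2)
  rw [div_le_div_iff₀ (by positivity) (by positivity)] at h8
  have h9 : (n : ℝ) = 2 * r.den := by rw [hn]; push_cast; ring
  rw [h9] at h8
  nlinarith

theorem isCloseFrom (hc : IsConstruction goodThreshold p₀ q₀ c) (n : ℕ) :
    analyticDist (n + 1) (stage p₀ q₀ c n).T (stage p₀ q₀ c (n + 1)).T <
        ENNReal.ofReal (rate n (c n).l (stage p₀ q₀ c n).q) ∧
      analyticDist (n + 1) (stage p₀ q₀ c n).T.symm (stage p₀ q₀ c (n + 1)).T.symm <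
        ENNReal.ofReal (rate n (c n).l (stage p₀ q₀ c n).q) :=
  isCloseFrom_goodThreshold ((hc.admissible n).exists_isCloseFrom (hc.regular n)) _ (hc.k_large n)

/-- The `T_n` and their inverses converge separately. The uniform bounds show that the limits are
mutually inverse: the limit of the inverses, applied to `T_n u`, is close to `T_n⁻¹ (T_n u) = u`. -/
theorem exists_limit_map (hc : IsConstruction goodThreshold p₀ q₀ c) :
    ∃ T : Torus ≃ Torus, IsAnalyticDiffeo T ∧ MeasurePreserving T volume volume ∧
      (∀ ρ : ℝ, 0 < ρ → MemDiff ρ T ∧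
        Tendsto (fun n => analyticDist ρ (stage p₀ q₀ c n).T T) atTop (𝓝 0)) ∧
      ∀ n u, dist ((stage p₀ q₀ c n).T u) (T u) ≤ 2 * ((1 / 4) ^ n / (c n).l) := by
  have htame : ∀ n t, HasTameDisplacement (conjFlow (stage p₀ q₀ c n).H t) := fun n t =>
    (hc.regular n).hasTameDisplacement_conjFlow t
  obtain ⟨T, f, hf, hmem, hlim, hdist⟩ := exists_limit hc.summable_rate
    (S := fun n => (stage p₀ q₀ c n).T) (fun n => htame n _) (fun n => (hc.isCloseFrom n).1)
  obtain ⟨T', f', hf', hmem', -, hdist'⟩ := exists_limit hc.summable_rate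
    (S := fun n => (stage p₀ q₀ c n).T.symm)
    (fun n => by rw [Stage.T_eq_conjFlow, conjFlow_symm]; exact htame n _)
    (fun n => (hc.isCloseFrom n).2)
  have htail := tendsto_sum_nat_add fun n => rate n (c n).l (stage p₀ q₀ c n).q
  have hT : ∀ u, Tendsto (fun n => (stage p₀ q₀ c n).T u) atTop (𝓝 (T u)) := fun u =>
    tendsto_iff_dist_tendsto_zero.2 (squeeze_zero (fun _ => dist_nonneg) (fun n => hdist n u) htail)
  have hT' : ∀ u, Tendsto (fun n => (stage p₀ q₀ c n).T.symm u) atTop (𝓝 (T' u)) := fun u =>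
    tendsto_iff_dist_tendsto_zero.2 (squeeze_zero (fun _ => dist_nonneg) (fun n => hdist' n u) htail)
  have hleft : ∀ u, T' (T u) = u := by
    intro u
    refine tendsto_nhds_unique ((hf'.continuous_map.tendsto _).comp (hT u))
      (tendsto_iff_dist_tendsto_zero.2 (squeeze_zero (fun _ => dist_nonneg) (fun n => ?_) htail))
    have := hdist' n ((stage p₀ q₀ c n).T u)
    rwa [Equiv.symm_apply_apply, dist_comm] at this
  have hright : ∀ u, T (T' u) = u := by
    intro u
    refine tendsto_nhds_unique ((hf.continuous_map.tendsto _).comp (hT' u))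
      (tendsto_iff_dist_tendsto_zero.2 (squeeze_zero (fun _ => dist_nonneg) (fun n => ?_) htail))
    have := hdist n ((stage p₀ q₀ c n).T.symm u)
    rwa [Equiv.apply_symm_apply, dist_comm] at this
  let E : Torus ≃ Torus := ⟨T, T', hleft, hright⟩
  have hdiffeo : IsAnalyticDiffeo E :=
    ⟨⟨_, hf.isAnalyticLift (hmem 1 one_pos)⟩, ⟨_, hf'.isAnalyticLift (hmem' 1 one_pos)⟩⟩
  have hmp : MeasurePreserving E volume volume :=
    measurePreserving_of_tendsto (fun n => (hc.regular n).measurePreserving_conjFlow _)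
      hf.continuous_map.measurable (Eventually.of_forall hT)
  exact ⟨E, hdiffeo, hmp, fun ρ hρ => ⟨⟨hdiffeo, hmp, f, hf, hmem ρ hρ⟩, hlim ρ hρ⟩,
    fun n u => (hdist n u).trans (hc.tsum_rate_le n)⟩

end IsConstruction

/-! ### The metric isomorphism -/

namespace IsConstruction

variable {p₀ q₀ : ℕ} {c : ℕ → Choice}

/-- Almost every point is eventually in the controlled part of the torus. -/
theorem ae_eventually_goodSet (hc : IsConstruction goodThreshold p₀ q₀ c) :
    ∀ᵐ x : Torus, ∀ᶠ n in atTop, (stage p₀ q₀ c n).H x ∈ goodSet (c n) (stage p₀ q₀ c n).q := by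
  have h := ae_eventually_notMem (μ := (volume : Measure Torus))
    (s := fun n => (stage p₀ q₀ c n).H ⁻¹' (goodSet (c n) (stage p₀ q₀ c n).q)ᶜ) ?_
  · simpa using h
  have hs : Summable fun n : ℕ => 6 * (1 / 2 : ℝ) ^ n :=
    (summable_geometric_of_lt_one (by norm_num) (by norm_num)).mul_left _
  refine ne_top_of_le_ne_top hs.tsum_ofReal_ne_top (ENNReal.tsum_le_tsum fun n => ?_)
  have hmp := (hc.regular n).measurePreserving
  refine (Measure.le_map_apply hmp.measurable.aemeasurable _).trans ?_
  rw [hmp.map_eq]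
  refine (volume_goodSet_compl_le (hc.l_pos n) (hc.regular n).q_pos
    (hc.admissible n).approx₁.isEntire.continuous.measurable).trans (ENNReal.ofReal_le_ofReal ?_)
  exact mul_le_mul_of_nonneg_left
    (pow_le_pow_of_le_one (by norm_num) (by norm_num) (hc.le_q n)) (by norm_num)

/-- The approximate inverses of the factor map. -/
def approxInverse (p₀ q₀ : ℕ) (c : ℕ → Choice) (n : ℕ) (y : UnitAddCircle) : Torus :=
  (stage p₀ q₀ c n).H.symm (y, -(((c n).l * (stage p₀ q₀ c n).q) • y))

theorem measurable_approxInverse (hc : IsConstruction goodThreshold p₀ q₀ c) (n : ℕ) :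
    Measurable (approxInverse p₀ q₀ c n) :=
  ((hc.regular n).continuous_symm.comp
    (continuous_id.prodMk (continuous_id.nsmul _).neg)).measurable

theorem dist_le (hc : IsConstruction goodThreshold p₀ q₀ c) (n : ℕ) (u v : Torus) :
    dist ((stage p₀ q₀ c n).H u) ((stage p₀ q₀ c n).H v) ≤
        2 * ((c n).l * (1 / 2) ^ n) * dist u v ∧
      dist ((stage p₀ q₀ c n).H.symm u) ((stage p₀ q₀ c n).H.symm v) ≤
        2 * ((c n).l * (1 / 2) ^ n) * dist u v :=
  (hc.regular n).lift.some.dist_le (by positivity) (hc.admissible n).derivSup_le u v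

/-- On the controlled points the first coordinates of the `H_n` converge, and the limit determines
the point. -/
theorem ae_exists_tendsto (hc : IsConstruction goodThreshold p₀ q₀ c) :
    ∀ᵐ x : Torus, ∃ y : UnitAddCircle,
      Tendsto (fun n => ((stage p₀ q₀ c n).H x).1) atTop (𝓝 y) ∧
        Tendsto (fun n => approxInverse p₀ q₀ c n y) atTop (𝓝 x) := by
  filter_upwards [hc.ae_eventually_goodSet] with x hx
  obtain ⟨N, hN⟩ := eventually_atTop.1 hx
  have hnear := fun n (hn : n ≥ N) =>
    (hc.admissible n).near_of_mem_goodSet (hc.l_pos n) (hc.regular n).q_pos (hN n hn)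
  have hnext : ∀ n, (c n).h (stage p₀ q₀ c n).q ((stage p₀ q₀ c n).H x) =
      (stage p₀ q₀ c (n + 1)).H x := fun n => rfl
  simp only [hnext] at hnear
  clear hnext
  obtain ⟨y, hy, hyd⟩ := exists_tendsto_of_dist_le (N := N)
    (f := fun n => ((stage p₀ q₀ c n).H x).1) (b := fun n => 2 / (stage p₀ q₀ c n).q)
    (fun n => hc.inv_q_succ_le zero_le_two n) (fun n hn => by
      rw [dist_comm]
      refine (hnear n hn).1.trans (div_le_div_of_nonneg_left (by norm_num) (hc.q_pos n) ?_)
      exact le_mul_of_one_le_left (hc.q_pos n).le (hc.one_le_l n))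
  refine ⟨y, hy, ?_⟩
  have hb : ∀ n ≥ N, dist (approxInverse p₀ q₀ c n y) x ≤ 10 * (1 / 2) ^ n := by
    intro n hn
    obtain ⟨h1, h2⟩ := hnear n hn
    have hl1 := hc.one_le_l n
    have hl : (0 : ℝ) < (c n).l := by linarith
    have hq := hc.q_pos n
    set l : ℝ := ((c n).l : ℝ) with hldef
    set q : ℝ := ((stage p₀ q₀ c n).q : ℝ) with hqdef
    set u := (stage p₀ q₀ c n).H x with hu
    set y' := ((stage p₀ q₀ c (n + 1)).H x).1 with hy'
    -- After step `n + 1` the first coordinate moves by at most `4 / q_{n+1}`, and `q_{n+1} ≥ 2 l²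
    -- q` because `k_n ≥ 2`. Multiplication by `l q` leaves an error `2 / l`, so replacing `y'` by
    -- its limit `y` keeps the encoding of `u.2`.
    have h3 : dist y' y ≤ 2 / (l ^ 2 * q) := by
      refine (hyd (n + 1) (by omega)).trans ?_
      rw [← mul_div_assoc, show (2 : ℝ) / (l ^ 2 * q) = 2 * 2 / (2 * l ^ 2 * q) by field_simp]
      exact div_le_div_of_nonneg_left (by norm_num) (by positivity) (hc.two_mul_q_le n)
    have h4 : 2 / (l ^ 2 * q) ≤ 2 / (l * q) :=
      div_le_div_of_nonneg_left (by norm_num) (by positivity) (by gcongr; nlinarith)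
    have hq1 : (1 : ℝ) ≤ q := by
      rw [hqdef]; exact_mod_cast (hc.regular n).q_pos
    have h5 : 2 / (l * q) ≤ 2 / l :=
      div_le_div_of_nonneg_left (by norm_num) hl (le_mul_of_one_le_right hl.le hq1)
    have h6 : 2 / l + 2 / l ≤ 5 / l := by
      rw [← add_div]; gcongr; norm_num
    have hfst : dist y u.1 ≤ 5 / l :=
      calc dist y u.1 ≤ dist y y' + dist y' u.1 := dist_triangle _ _ _
        _ ≤ 2 / l + 2 / l := by rw [dist_comm y]; linarith
        _ ≤ 5 / l := h6
    have hsnd : dist (-(((c n).l * (stage p₀ q₀ c n).q) • y)) u.2 ≤ 5 / l := by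
      have e : u.2 - -(((c n).l * (stage p₀ q₀ c n).q) • y) =
          (u.2 + ((c n).l * (stage p₀ q₀ c n).q) • y') -
            ((c n).l * (stage p₀ q₀ c n).q) • (y' - y) := by
        rw [smul_sub]; abel
      rw [dist_comm, dist_eq_norm, e]
      refine (norm_sub_le _ _).trans ?_
      have h7 : ‖((c n).l * (stage p₀ q₀ c n).q) • (y' - y)‖ ≤ 2 / l := by
        refine (norm_nsmul_le).trans ?_
        rw [← dist_eq_norm]
        push_cast
        calc l * q * dist y' y ≤ l * q * (2 / (l ^ 2 * q)) := by gcongr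
          _ = 2 / l := by field_simp
      calc _ ≤ 3 / l + 2 / l := add_le_add h2 h7
        _ = 5 / l := by ring
    have h8 := (hc.dist_le n (y, -(((c n).l * (stage p₀ q₀ c n).q) • y)) u).2
    rw [hu, Equiv.symm_apply_apply] at h8
    refine h8.trans ?_
    calc _ ≤ 2 * (l * (1 / 2) ^ n) * (5 / l) := by
          gcongr
          exact max_le hfst hsnd
      _ = 10 * (1 / 2) ^ n := by field_simp; norm_num
  refine tendsto_iff_dist_tendsto_zero.2 (squeeze_zero' (Eventually.of_forall fun _ => dist_nonneg)
    (eventually_atTop.2 ⟨N, hb⟩) ?_)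
  have := (tendsto_pow_atTop_nhds_zero_of_lt_one (r := (1 / 2 : ℝ)) (by norm_num)
    (by norm_num)).const_mul 10
  rwa [mul_zero] at this

/-- `K` preserves measure as a limit of the maps `x ↦ (H_n x).1`. Almost every `y` behaves like a
value of `K`, since `K` carries Lebesgue measure to Lebesgue measure; thus the approximate inverses
converge almost everywhere to some `J`, and `J ∘ K = id` yields both that `J` preserves measure and
that `K ∘ J = id`. -/
theorem metricallyIsomorphic (hc : IsConstruction goodThreshold p₀ q₀ c) {T : Torus ≃ Torus}
    (hT : MeasurePreserving T volume volume)
    (hTd : ∀ n u, dist ((stage p₀ q₀ c n).T u) (T u) ≤ 2 * ((1 / 4) ^ n / (c n).l)) {α : ℝ}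
    (hα : Tendsto (fun n => (stage p₀ q₀ c n).alpha) atTop (𝓝 α)) :
    MetricallyIsomorphic (volume : Measure Torus) T (volume : Measure UnitAddCircle)
      fun y => y + (α : UnitAddCircle) := by
  have hex := hc.ae_exists_tendsto
  have hfst : ∀ n, MeasurePreserving (fun x : Torus => ((stage p₀ q₀ c n).H x).1) volume volume :=
    fun n => (measurePreserving_fst (μ := (volume : Measure UnitAddCircle))
      (ν := (volume : Measure UnitAddCircle))).comp (hc.regular n).measurePreserving
  obtain ⟨K, hKm, hKlim⟩ := measurable_limit_of_tendsto_metrizable_ae (μ := (volume : Measure Torus))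
    (L := atTop) (fun n => (hfst n).measurable.aemeasurable)
    (hex.mono fun x ⟨y, hy, _⟩ => ⟨y, hy⟩)
  have hK : MeasurePreserving K volume volume := measurePreserving_of_tendsto hfst hKm hKlim
  have hsec : ∀ᵐ x : Torus, Tendsto (fun n => approxInverse p₀ q₀ c n (K x)) atTop (𝓝 x) := by
    filter_upwards [hex, hKlim] with x ⟨y, hy, hyx⟩ hx
    rwa [tendsto_nhds_unique hx hy]
  have hsecex : ∀ᵐ y : UnitAddCircle, ∃ x, Tendsto (fun n => approxInverse p₀ q₀ c n y) atTop (𝓝 x) := by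
    rw [← hK.map_eq, ae_map_iff hKm.aemeasurable
      (measurableSet_exists_tendsto fun n => hc.measurable_approxInverse n)]
    exact hsec.mono fun x hx => ⟨x, hx⟩
  obtain ⟨J, hJm, hJlim⟩ := measurable_limit_of_tendsto_metrizable_ae
    (μ := (volume : Measure UnitAddCircle)) (L := atTop)
    (fun n => (hc.measurable_approxInverse n).aemeasurable) hsecex
  have hJK : ∀ᵐ x : Torus, J (K x) = x := by
    filter_upwards [hK.quasiMeasurePreserving.ae hJlim, hsec] with x h1 h2
    exact tendsto_nhds_unique h1 h2
  have hJ : MeasurePreserving J volume volume := by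
    refine ⟨hJm, ?_⟩
    rw [← hK.map_eq, Measure.map_map hJm hKm, Measure.map_congr (f := J ∘ K) (g := id) hJK, Measure.map_id]
  refine ⟨K, J, hK, hJ, hJK, ?_, ?_⟩
  · rw [← hK.map_eq, ae_map_iff hKm.aemeasurable
      (measurableSet_eq_fun (f := fun y => K (J y)) (g := fun y => y) (hKm.comp hJm) measurable_id)]
    filter_upwards [hJK] with x hx
    rw [hx]
  · filter_upwards [hKlim, hT.quasiMeasurePreserving.ae hKlim] with x hx hTx
    have h1 : ∀ n, ((stage p₀ q₀ c n).H ((stage p₀ q₀ c n).T x)).1 =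
        ((stage p₀ q₀ c n).H x).1 + ((stage p₀ q₀ c n).alpha : UnitAddCircle) := by
      intro n
      rw [Stage.T_eq_conjFlow, conjFlow_apply, Equiv.apply_symm_apply]
      rfl
    have h2 : Tendsto (fun n => ((stage p₀ q₀ c n).H ((stage p₀ q₀ c n).T x)).1) atTop
        (𝓝 (K x + (α : UnitAddCircle))) := by
      simp only [h1]
      exact hx.add (((AddCircle.continuous_mk' 1).tendsto α).comp hα)
    refine tendsto_nhds_unique hTx (h2.congr_dist (squeeze_zero (fun _ => dist_nonneg)
      (g := fun n : ℕ => 4 * (1 / 2 : ℝ) ^ n) (fun n => ?_) ?_))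
    · have hl : (0 : ℝ) < (c n).l := by linarith [hc.one_le_l n]
      have hp : (1 / 8 : ℝ) ^ n ≤ (1 / 2) ^ n := pow_le_pow_left₀ (by norm_num) (by norm_num) n
      -- The Lipschitz constant `2 l_n / 2^n` of `H_n` meets the distance `2 / (4^n l_n)` from `T_n`
      -- to `T`: the factor `l_n` cancels.
      calc dist ((stage p₀ q₀ c n).H ((stage p₀ q₀ c n).T x)).1 ((stage p₀ q₀ c n).H (T x)).1
          ≤ dist ((stage p₀ q₀ c n).H ((stage p₀ q₀ c n).T x)) ((stage p₀ q₀ c n).H (T x)) :=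
            le_max_left _ _
        _ ≤ 2 * ((c n).l * (1 / 2) ^ n) * (2 * ((1 / 4) ^ n / (c n).l)) :=
            (hc.dist_le n _ _).1.trans (by gcongr; exact hTd n x)
        _ = 4 * (1 / 8) ^ n := by
            rw [show (1 / 8 : ℝ) = 1 / 2 * (1 / 4) by norm_num, mul_pow]
            field_simp
            norm_num
        _ ≤ 4 * (1 / 2) ^ n := by gcongr
    · have := (tendsto_pow_atTop_nhds_zero_of_lt_one (r := (1 / 2 : ℝ)) (by norm_num)
        (by norm_num)).const_mul 4
      rwa [mul_zero] at this

end IsConstruction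

end AbC

end

theorem mainTheorem2 :
    (∀ (κ : AbC.Threshold) (p₀ q₀ : ℕ), p₀ < q₀ →
      ∃ c : ℕ → AbC.Choice, AbC.IsConstruction κ p₀ q₀ c) ∧
    ∃ κ : AbC.Threshold, ∀ (p₀ q₀ : ℕ) (c : ℕ → AbC.Choice), AbC.IsConstruction κ p₀ q₀ c →
      ∃ (α : ℝ) (T : AbC.Torus ≃ AbC.Torus),
        Tendsto (fun n => (AbC.stage p₀ q₀ c n).alpha) atTop (𝓝 α) ∧
        Irrational α ∧
        (∀ ρ : ℝ, 0 < ρ →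
          (∀ n, AbC.MemDiff ρ (AbC.stage p₀ q₀ c n).T) ∧
          AbC.MemDiff ρ T ∧
          Tendsto (fun n => AbC.analyticDist ρ (AbC.stage p₀ q₀ c n).T T) atTop (𝓝 0)) ∧
        AbC.IsAnalyticDiffeo T ∧
        MeasurePreserving T volume volume ∧
        AbC.MetricallyIsomorphic (volume : Measure AbC.Torus) T
          (volume : Measure UnitAddCircle) (fun y => y + (α : UnitAddCircle)) := by
  refine ⟨fun κ p₀ q₀ h => AbC.exists_isConstruction κ h, AbC.goodThreshold,
    fun p₀ q₀ c hc => ?_⟩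
  obtain ⟨α, hα, hirr⟩ := hc.exists_alpha
  obtain ⟨T, hdiffeo, hmp, hρ, hdist⟩ := hc.exists_limit_map
  exact ⟨α, T, hα, hirr, fun ρ h => ⟨fun n => (hc.regular n).memDiff h, hρ ρ h⟩, hdiffeo, hmp,
    hc.metricallyIsomorphic hmp hdist hα⟩
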